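/- **Setting.** Consider compressible isentropic neo-Hookean elastodynamics in three space dimensions, with density $\rho$, velocity $v\in\mathbb R^3$, deformation gradient $F=(F_{ij})$ with columns $F_1,F_2,F_3$, and pressure $p=p(\rho)$ a smooth function of $\rho>0$: $$\partial_t\rho+\operatorname{div}(\rho v)=0,\quad \partial_t(\rho v)+\operatorname{div}(\rho v\otimes v)+\nabla p-\operatorname{div}(\rho FF^\top)=0,\quad \partial_t(\rho F_j)+\operatorname{div}(\rho F_j\otimes v-v\otimes\rho F_j)=0,\quad \operatorname{div}(\rho F_j)=0 .$$ A planar shock $x_1=0$ is given by constant states with densities $\hat\rho^\pm>0$, $\hat\rho^+\neq\hat\rho^-$, velocities $(\hat v_1^\pm,0,0)$ with $\hat v_1^\pm>0$, and deformation gradients $\widehat F^\pm$ ($+$ for $x_1>0$, behind the shock; $-$ for $x_1<0$), such that $p'(\hat\rho^\pm)>0$ and the Rankine–Hugoniot conditions hold: $$\frac{\hat\rho^+}{\hat\rho^-}=\frac{\hat v_1^-}{\hat v_1^+},\qquad \frac{\hat\rho^+}{\hat\rho^-}\Big\{(\hat v_1^+)^2-\sum_{j=1}^3(\widehat F_{1j}^+)^2\Big\}(\hat\rho^+-\hat\rho^-)=p(\hat\rho^+)-p(\hat\rho^-),\qquad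 \widehat F^+_{lj}=\widehat F^-_{lj}\ (l=2,3),\qquad \hat\rho^+\widehat F^+_{1j}=\hat\rho^-\widehat F^-_{1j}$$ for $j=1,2,3$. Put $\hat c^\pm=\sqrt{p'(\hat\rho^\pm)}$, $M=\hat v_1^+/\hat c^+$, $M_-=\hat v_1^- /\hat c^-$, $R=\hat\rho^+/\hat\rho^-$, $\mathcal F_{ij}=\widehat F^+_{ij}/\hat c^+$, let $r_i=(\mathcal F_{i1},\mathcal F_{i2},\mathcal F_{i3})$ and $\mathcal F_j=(\mathcal F_{1j},\mathcal F_{2j},\mathcal F_{3j})^\top$ be the rows and columns of $\mathcal F$, and put $$M_1=|r_1|,\quad M_*=\sqrt{1+|r_1|^2},\quad \beta=\sqrt{M_*^2-M^2},\quad d_0=\frac{M_*^2+M^2}{2M^2},\quad a_0=-\frac{\beta^2R}{2M^2},\quad \ell_2=r_1\cdot r_2,\quad \ell_3=r_1\cdot r_3 .$$ **Linearized problem.** For $U=(p,v,F_1,F_2,F_3)\in\mathbb R^{13}$ and the front perturbation $\varphi$, with $L=\partial_t+\partial_1$ and $\partial_\star=\partial_t-M^{-2}(\ell_2\partial_2+\ell_3\partial_3)$,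 the dimensionless linearized problem is $$Lp+\operatorname{div}v=0,\quad M^2Lv+\nabla p-\sum_{j=1}^3(\mathcal F_j\cdot\nabla)F_j=0,\quad LF_j-(\mathcal F_j\cdot\nabla)v=0\qquad(x_1>0),$$ $$v_1+d_0p-\frac{\ell_2v_2+\ell_3v_3}{M^2R}=0,\quad a_0p+(1-R)\partial_\star\varphi=0,\quad v_k+(1-R)\partial_k\varphi=0,\quad F_{1j}+\mathcal F_{1j}p-\frac{\mathcal F_{2j}v_2+\mathcal F_{3j}v_3}{R}=0,\quad F_{kj}-\mathcal F_{1j}v_k=0\qquad(x_1=0)$$ with $j=1,2,3$, $k=2,3$. Write the interior equations as $\mathcal A_0\partial_tU+\sum_{j=1}^3\mathcal A_j\partial_jU=0$ with $\mathcal A_0=\operatorname{diag}(1,M^2I_3,I_9)$ and symmetric $\mathcal A_j$. **Stability notions.** Let $s=\eta+i\xi$ and $\omega'=(\omega_2,\omega_3)$ with $\eta\ge0$ and $\xi,\omega_2,\omega_3\in\mathbb R$. For $\eta>0$ let $\lambda^+=\lambda^+(\eta,\xi,\omega')$ be the single root with $\operatorname{Re}\lambda>0$ of $\det(s\mathcal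 A_0+\lambda\mathcal A_1+i\omega_2\mathcal A_2+i\omega_3\mathcal A_3)=0$, and put $\lambda^+(0,\xi,\omega')=\lim_{\eta\to+0}\lambda^+(\eta,\xi,\omega')$. Let $\widetilde U_0\in\mathbb C^{13}\setminus\{0\}$ be such that, with some $\tilde\varphi\in\mathbb C$, it satisfies the boundary conditions above after the replacement of $\partial_t,\partial_2,\partial_3$ by $s,i\omega_2,i\omega_3$. Let $\mathfrak L$ be the $13\times13$ matrix of the linear system for $X\in\mathbb C^{13}$ consisting of $12$ linearly independent equations of $(s\mathcal A_0+\lambda^+\mathcal A_1+i\omega_2\mathcal A_2+i\omega_3\mathcal A_3)X=0$ and of the equation $(\mathcal A_1\widetilde U_0)\cdot X=0$ (bilinear product). The *KL condition* holds if for all $\eta>0$ and $(\xi,\omega')\in\mathbb R^3$ the root $\lambda^+$ exists and $\det\mathfrak L\ne0$; the *UKL condition* holds if, moreover, for $\eta=0$ and all $(\xi,\omega')\in\mathbb R^3\setminus\{0\}$ the limit $\lambda^+$ exists and $\det\mathfrak L\neq0$. The shock is *uniformly stable* if UKL holds, *weakly stable* if KL holds but UKL does not, and *violently unstable* if KL fails.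 **Theorem.** Suppose that the planar shock satisfies the Lax conditions $$M_->\frac{M}{\sqrt{M^2-M_1^2}},\qquad M_1<M<M_* .$$ Then it is uniformly stable if and only if $$\min_{\bar\omega_2^2+\bar\omega_3^2=1}\Big(M\sqrt{1+|r_1|^2+|\bar\omega_2r_2+\bar\omega_3r_3|^2+|r_1\times(\bar\omega_2r_2+\bar\omega_3r_3)|^2}-\big|r_1\cdot(\bar\omega_2r_2+\bar\omega_3r_3)\big|\sqrt{1+|r_1|^2-M^2}\Big)^2-\big(1+|r_1|^2\big)^2\big(R(M^2-|r_1|^2)-1\big)>0 .$$ If this inequality is violated, then the shock is weakly stable. In particular, the shock is never violently unstable. -/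

import Mathlib

open Filter Topology Matrix

noncomputable section

namespace ElasticShock

/-- Euclidean length of a vector of `ℝ³` (the type `Fin 3 → ℝ` itself carries the sup norm). -/
def vnorm (a : Fin 3 → ℝ) : ℝ := √(a ⬝ᵥ a)

/-- A planar shock `x₁ = 0` of compressible isentropic neo-Hookean elastodynamics with equation of
state `p = p(ρ)`, in a reference frame where the tangential velocity vanishes: constant states ahead
(`Minus`, for `x₁ < 0`) and behind (`Plus`, for `x₁ > 0`) which satisfy the hyperbolicity conditions
and the Rankine-Hugoniot conditions. The entry `F i j` is the component `F_{ij}` of the deformation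
gradient; the indices `1, 2, 3` are `0, 1, 2 : Fin 3`. -/
structure PlanarShock where
  /-- pressure as a function of the density -/
  p : ℝ → ℝ
  p_smooth : ContDiffOn ℝ ((⊤ : ℕ∞) : WithTop ℕ∞) p (Set.Ioi 0)
  ρPlus : ℝ
  ρMinus : ℝ
  /-- normal velocity behind the shock -/
  vPlus : ℝ
  /-- normal velocity ahead of the shock -/
  vMinus : ℝ
  FPlus : Matrix (Fin 3) (Fin 3) ℝ
  FMinus : Matrix (Fin 3) (Fin 3) ℝ
  ρPlus_pos : 0 < ρPlus
  ρMinus_pos : 0 < ρMinus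
  vPlus_pos : 0 < vPlus
  vMinus_pos : 0 < vMinus
  hyperbolicPlus : 0 < deriv p ρPlus
  hyperbolicMinus : 0 < deriv p ρMinus
  /-- a shock has a density jump -/
  ρ_jump : ρPlus ≠ ρMinus
  mass : ρPlus / ρMinus = vMinus / vPlus
  momentum : ρPlus / ρMinus * (vPlus ^ 2 - (FPlus 0 0 ^ 2 + FPlus 0 1 ^ 2 + FPlus 0 2 ^ 2))
    * (ρPlus - ρMinus) = p ρPlus - p ρMinus
  deform_tangential : ∀ l j : Fin 3, l ≠ 0 → FPlus l j = FMinus l j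
  deform_normal : ∀ j : Fin 3, ρPlus * FPlus 0 j = ρMinus * FMinus 0 j

namespace PlanarShock

variable (S : PlanarShock)

/-- Sound speed behind the shock, `c² = p'(ρ)`. -/
def cPlus : ℝ := √(deriv S.p S.ρPlus)

/-- Sound speed ahead of the shock. -/
def cMinus : ℝ := √(deriv S.p S.ρMinus)

/-- Downstream Mach number `M`. -/
def mach : ℝ := S.vPlus / S.cPlus

/-- Upstream Mach number `M_-`. -/
def machMinus : ℝ := S.vMinus / S.cMinus

/-- `R = ρ⁺ / ρ⁻`. -/
def ratio : ℝ := S.ρPlus / S.ρMinus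

/-- Scaled deformation gradient behind the shock, `𝓕_{ij} = F⁺_{ij} / c⁺`; its `i`-th (transposed)
row is `S.scaledF i`. -/
def scaledF : Matrix (Fin 3) (Fin 3) ℝ := fun i j => S.FPlus i j / S.cPlus

end PlanarShock

/-! ### The dimensionless linearized problem

It depends on the downstream Mach number `M`, the density ratio `R` and the scaled deformation
gradient `𝓕` only. -/

/-- `M₁`, the length of the first row of `𝓕`. -/
def M₁ (𝓕 : Matrix (Fin 3) (Fin 3) ℝ) : ℝ := vnorm (𝓕 0)

/-- `M_* = √(1 + |row₁|²)`. -/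
def MStar (𝓕 : Matrix (Fin 3) (Fin 3) ℝ) : ℝ := √(1 + vnorm (𝓕 0) ^ 2)

/-- Index set of the 13 components of `U = (p, v, F₁, F₂, F₃)`. -/
abbrev Idx : Type := Unit ⊕ (Fin 3 ⊕ (Fin 3 × Fin 3))

/-- Index of the pressure component. -/
abbrev ip : Idx := Sum.inl ()

/-- Index of the velocity component `v_k`. -/
abbrev iv (k : Fin 3) : Idx := Sum.inr (Sum.inl k)

/-- Index of the component `F_{kj}`, the `k`-th component of the column `F_j`. -/
abbrev iF (k j : Fin 3) : Idx := Sum.inr (Sum.inr (k, j))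

/-- `𝓐₀ = diag (1, M² I₃, I₉)`. -/
def coeffA₀ (M : ℝ) : Matrix Idx Idx ℝ :=
  Matrix.diagonal fun
    | Sum.inl _ => 1
    | Sum.inr (Sum.inl _) => M ^ 2
    | Sum.inr (Sum.inr _) => 1

/-- The part of `𝓐_j` which comes from `div v`, `∇p` and the elastic terms. -/
def coeffB (𝓕 : Matrix (Fin 3) (Fin 3) ℝ) (j : Fin 3) : Matrix Idx Idx ℝ := fun
  | Sum.inl _, Sum.inr (Sum.inl k) => if k = j then 1 else 0
  | Sum.inr (Sum.inl k), Sum.inl _ => if k = j then 1 else 0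
  | Sum.inr (Sum.inl k), Sum.inr (Sum.inr (k', l)) => if k = k' then -𝓕 j l else 0
  | Sum.inr (Sum.inr (k', l)), Sum.inr (Sum.inl k) => if k = k' then -𝓕 j l else 0
  | _, _ => 0

/-- The matrices `𝓐₁, 𝓐₂, 𝓐₃` of the linearized system
`𝓐₀ ∂_t U + 𝓐₁ ∂₁ U + 𝓐₂ ∂₂ U + 𝓐₃ ∂₃ U = 0` in `x₁ > 0`
(indexed by `j = 0, 1, 2`): `𝓐_j = δ_{1j} 𝓐₀ + ` the matrix above. -/
def coeffA (M : ℝ) (𝓕 : Matrix (Fin 3) (Fin 3) ℝ) (j : Fin 3) : Matrix Idx Idx ℝ :=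
  (if j = 0 then coeffA₀ M else 0) + coeffB 𝓕 j

/-- `s 𝓐₀ + λ 𝓐₁ + i ω₂ 𝓐₂ + i ω₃ 𝓐₃`. -/
def symbol (M : ℝ) (𝓕 : Matrix (Fin 3) (Fin 3) ℝ) (s lam : ℂ) (ω₂ ω₃ : ℝ) : Matrix Idx Idx ℂ :=
  s • (coeffA₀ M).map Complex.ofReal + lam • (coeffA M 𝓕 0).map Complex.ofReal
    + (Complex.I * ω₂) • (coeffA M 𝓕 1).map Complex.ofReal
    + (Complex.I * ω₃) • (coeffA M 𝓕 2).map Complex.ofReal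

/-- `lam` is the single root of the dispersion relation in the open right half-plane. -/
def IsLambdaPlus (M : ℝ) (𝓕 : Matrix (Fin 3) (Fin 3) ℝ) (s : ℂ) (ω₂ ω₃ : ℝ) (lam : ℂ) : Prop :=
  (symbol M 𝓕 s lam ω₂ ω₃).det = 0 ∧ 0 < lam.re ∧
    ∀ μ : ℂ, (symbol M 𝓕 s μ ω₂ ω₃).det = 0 → 0 < μ.re → μ = lam

/-- `d₀ = (M_*² + M²) / (2 M²)`. -/
def d₀ (M : ℝ) (𝓕 : Matrix (Fin 3) (Fin 3) ℝ) : ℝ := (MStar 𝓕 ^ 2 + M ^ 2) / (2 * M ^ 2)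

/-- `β = √(M_*² - M²)`. -/
def β (M : ℝ) (𝓕 : Matrix (Fin 3) (Fin 3) ℝ) : ℝ := √(MStar 𝓕 ^ 2 - M ^ 2)

/-- `a₀ = -β² R / (2 M²)`. -/
def a₀ (M R : ℝ) (𝓕 : Matrix (Fin 3) (Fin 3) ℝ) : ℝ := -(β M 𝓕 ^ 2 * R) / (2 * M ^ 2)

/-- `ℓ₂`, the inner product of the first and second rows of `𝓕`. -/
def ℓ₂ (𝓕 : Matrix (Fin 3) (Fin 3) ℝ) : ℝ := 𝓕 0 ⬝ᵥ 𝓕 1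

/-- `ℓ₃`, the inner product of the first and third rows of `𝓕`. -/
def ℓ₃ (𝓕 : Matrix (Fin 3) (Fin 3) ℝ) : ℝ := 𝓕 0 ⬝ᵥ 𝓕 2

/-- The Fourier-Laplace symbol of `∂_⋆ = ∂_t - M⁻² (ℓ₂ ∂₂ + ℓ₃ ∂₃)`. -/
def dStar (M : ℝ) (𝓕 : Matrix (Fin 3) (Fin 3) ℝ) (s : ℂ) (ω₂ ω₃ : ℝ) : ℂ :=
  s - 1 / (M : ℂ) ^ 2 * (ℓ₂ 𝓕 * (Complex.I * ω₂) + ℓ₃ 𝓕 * (Complex.I * ω₃))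

/-- `U`, together with some amplitude `φ` of the shock front, satisfies the Fourier-Laplace transform
of the linearized Rankine-Hugoniot conditions on `x₁ = 0`:
`v₁ + d₀ p - (M² R)⁻¹ (ℓ₂ v₂ + ℓ₃ v₃) = 0`, `a₀ p + (1 - R) ∂_⋆ φ = 0`, `v_k + (1 - R) ∂_k φ = 0`,
`F_{1j} + 𝓕_{1j} p - R⁻¹ (𝓕_{2j} v₂ + 𝓕_{3j} v₃) = 0`, `F_{kj} - 𝓕_{1j} v_k = 0`
(`j = 1, 2, 3`, `k = 2, 3`). -/
def SatisfiesBC (M R : ℝ) (𝓕 : Matrix (Fin 3) (Fin 3) ℝ) (s : ℂ) (ω₂ ω₃ : ℝ) (U : Idx → ℂ) : Prop :=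
  ∃ φ : ℂ,
    U (iv 0) + d₀ M 𝓕 * U ip
        - 1 / ((M : ℂ) ^ 2 * R) * (ℓ₂ 𝓕 * U (iv 1) + ℓ₃ 𝓕 * U (iv 2)) = 0 ∧
    a₀ M R 𝓕 * U ip + (1 - (R : ℂ)) * (dStar M 𝓕 s ω₂ ω₃ * φ) = 0 ∧
    U (iv 1) + (1 - (R : ℂ)) * (Complex.I * ω₂ * φ) = 0 ∧
    U (iv 2) + (1 - (R : ℂ)) * (Complex.I * ω₃ * φ) = 0 ∧
    (∀ j : Fin 3, U (iF 0 j) + 𝓕 0 j * U ip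
        - 1 / (R : ℂ) * (𝓕 1 j * U (iv 1) + 𝓕 2 j * U (iv 2)) = 0) ∧
    (∀ j : Fin 3, U (iF 1 j) - 𝓕 0 j * U (iv 1) = 0) ∧
    (∀ j : Fin 3, U (iF 2 j) - 𝓕 0 j * U (iv 2) = 0)

/-- The matrix `𝔏` of the linear system for `X` which consists of the equations of
`(s 𝓐₀ + λ 𝓐₁ + i ω₂ 𝓐₂ + i ω₃ 𝓐₃) X = 0` other than the `i`-th one and of
`(𝓐₁ U₀) · X = 0` (placed in row `i`; the product is bilinear, without conjugation). -/
def lopatinskiMatrix (M : ℝ) (𝓕 : Matrix (Fin 3) (Fin 3) ℝ) (s lam : ℂ) (ω₂ ω₃ : ℝ)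
    (i : Idx) (U₀ : Idx → ℂ) : Matrix Idx Idx ℂ :=
  (symbol M 𝓕 s lam ω₂ ω₃).updateRow i ((coeffA M 𝓕 0).map Complex.ofReal *ᵥ U₀)

/-- The Lopatinski determinant `det 𝔏` does not vanish at the given frequency, where `𝔏` is formed
with 12 linearly independent equations of the first system and a nonzero vector `U₀` satisfying the
boundary conditions (`U₀` is unique up to a nonzero factor for nonzero frequencies, and whether
`det 𝔏` vanishes does not depend on the choice of the 12 equations). -/
def LopatinskiNonzero (M R : ℝ) (𝓕 : Matrix (Fin 3) (Fin 3) ℝ) (s lam : ℂ) (ω₂ ω₃ : ℝ) : Prop :=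
  ∃ (i : Idx) (U₀ : Idx → ℂ), U₀ ≠ 0 ∧ SatisfiesBC M R 𝓕 s ω₂ ω₃ U₀ ∧
    LinearIndependent ℂ (fun r : {r : Idx // r ≠ i} => symbol M 𝓕 s lam ω₂ ω₃ r.1) ∧
    (lopatinskiMatrix M 𝓕 s lam ω₂ ω₃ i U₀).det ≠ 0

/-- The Kreiss-Lopatinski condition: `det 𝔏 ≠ 0` at `λ = λ⁺(η, ξ, ω')` for all `η > 0` and all real
`ξ, ω₂, ω₃`, where `s = η + i ξ`. -/
def KL (M R : ℝ) (𝓕 : Matrix (Fin 3) (Fin 3) ℝ) : Prop :=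
  ∀ η ξ ω₂ ω₃ : ℝ, 0 < η → ∃ lam : ℂ,
    IsLambdaPlus M 𝓕 (η + Complex.I * ξ) ω₂ ω₃ lam ∧
    LopatinskiNonzero M R 𝓕 (η + Complex.I * ξ) lam ω₂ ω₃

/-- The uniform Kreiss-Lopatinski condition: `det 𝔏 ≠ 0` at `λ = λ⁺(η, ξ, ω')` for all `η ≥ 0` and
all real `ξ, ω₂, ω₃`, not all of `η, ξ, ω₂, ω₃` being zero, where
`λ⁺(0, ξ, ω') = lim_{η → +0} λ⁺(η, ξ, ω')`. -/
def UKL (M R : ℝ) (𝓕 : Matrix (Fin 3) (Fin 3) ℝ) : Prop :=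
  KL M R 𝓕 ∧
  ∀ ξ ω₂ ω₃ : ℝ, (ξ ≠ 0 ∨ ω₂ ≠ 0 ∨ ω₃ ≠ 0) → ∃ (lamPlus : ℝ → ℂ) (lam₀ : ℂ),
    (∀ η : ℝ, 0 < η → IsLambdaPlus M 𝓕 (η + Complex.I * ξ) ω₂ ω₃ (lamPlus η)) ∧
    Tendsto lamPlus (𝓝[>] 0) (𝓝 lam₀) ∧
    LopatinskiNonzero M R 𝓕 (Complex.I * ξ) lam₀ ω₂ ω₃

/-- The explicit inequality `min_{ω̄₂² + ω̄₃² = 1} ( … )² - (1 + |r₁|²)² (R (M² - |r₁|²) - 1) > 0`, where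
`r₁, r₂, r₃` are the rows of `𝓕`. -/
def StabilityInequality (M R : ℝ) (𝓕 : Matrix (Fin 3) (Fin 3) ℝ) : Prop :=
  ∃ m : ℝ,
    IsLeast {y : ℝ | ∃ w₂ w₃ : ℝ, w₂ ^ 2 + w₃ ^ 2 = 1 ∧
      y = (M * √(1 + vnorm (𝓕 0) ^ 2 + vnorm (w₂ • 𝓕 1 + w₃ • 𝓕 2) ^ 2
              + vnorm (crossProduct (𝓕 0) (w₂ • 𝓕 1 + w₃ • 𝓕 2)) ^ 2)
            - |𝓕 0 ⬝ᵥ (w₂ • 𝓕 1 + w₃ • 𝓕 2)| * √(1 + vnorm (𝓕 0) ^ 2 - M ^ 2)) ^ 2} m ∧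
    m - (1 + vnorm (𝓕 0) ^ 2) ^ 2 * (R * (M ^ 2 - vnorm (𝓕 0) ^ 2) - 1) > 0

namespace PlanarShock

variable (S : PlanarShock)

/-- The UKL condition holds for the linearized problem. -/
def UniformlyStable : Prop := UKL S.mach S.ratio S.scaledF

/-- The KL condition holds, but the UKL condition is violated. -/
def WeaklyStable : Prop := KL S.mach S.ratio S.scaledF ∧ ¬ UKL S.mach S.ratio S.scaledF

/-- Even the KL condition is violated. -/
def ViolentlyUnstable : Prop := ¬ KL S.mach S.ratio S.scaledF

end PlanarShock

end ElasticShock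

end

/-!
# Stability of planar shocks in isentropic neo-Hookean elastodynamics

Write `r₁, r₂, r₃` for the rows of `𝓕`, `b = ω₂ r₂ + ω₃ r₃`, `ℓ = r₁ · b`, `W = ω₂² + ω₃²`,
`E = M_*² = 1 + |r₁|²`, `κ = M² - |r₁|²`, `T = s + λ`, and let `k = (λ, i ω₂, i ω₃)`, `g = λ r₁ + i b`
be the symbols of the gradient and of the derivatives along the columns of `𝓕`.

Eliminating pressure and deformation, a kernel vector of the symbol with `T ≠ 0` has a velocity with
`(M² T² - g·g) v = (k·v) k`. Hence `λ` is a shear root, `M² T² = g·g`, or an acoustic root,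
`M² T² = g·g + k·k` (`dispersion_of_det_symbol_eq_zero`). Shear roots never have positive real part
(`not_dispersion_shear`). The acoustic relation is quadratic in `λ`; for `η > 0` exactly one of its
roots lies in the right half-plane, and the explicit branch `acousticRoot` of the square root is
continuous up to `η = 0`. There the kernel is spanned by `(-k·k, T k, k ⊗ g)`
(`eq_smul_acousticVec`); since the symbol is symmetric, any row at which this vector does not vanish
may be omitted, and `det 𝔏 ≠ 0` says that `𝓐₁ U₀` is not orthogonal to this vector.

The boundary conditions express `U₀` by the front amplitude, and the pairing collapses by the dispersion
relation to a multiple of `T (β² λ² + (κ R - 1) W)` (`boundary_pairing`, `lopatinskiNonzero_iff`). The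
second factor has no zero with `Re λ > 0` (`reduced_lopatinski_ne_zero`), so KL always holds and only
imaginary `λ` at `η = 0` matter. There `β |λ|` satisfies `E β |λ| ≥ M N - |ℓ| β` with
`N² = E (|b|² + W) - ℓ²` (`le_mul_abs_im_acousticRoot`), and for one of `±ω'` every larger value is
attained (`exists_acousticRoot_eq`, by the intermediate value theorem). A zero, that is
`β |λ| = √((κ R - 1) W)`, is therefore absent for all `ω'` if and only if
`(M N - |ℓ| β)² > E² (κ R - 1) W` for all `ω' ≠ 0`, which is the stated inequality by homogeneity and
Lagrange's identity `|r₁ × b|² = |r₁|² |b|² - ℓ²`.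
-/

namespace ElasticShock

/-! ### The dispersion relation -/

/-- The scalar dispersion relation `M² (s + λ)² = a λ² + 2 i ℓ λ - C` of one wave family. With
`b = ω₂ r₂ + ω₃ r₃` and `ℓ = r₁ · b`, shear waves have `a = |r₁|²`, `C = |b|²`, and acoustic waves have
`a = 1 + |r₁|²`, `C = |b|² + |ω'|²`. -/
def Dispersion (M a ℓ C : ℝ) (s lam : ℂ) : Prop :=
  (M : ℂ) ^ 2 * (s + lam) ^ 2 = a * lam ^ 2 + 2 * Complex.I * ℓ * lam - C

theorem dispersion_iff_re_im {M a ℓ C : ℝ} {s lam : ℂ} :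
    Dispersion M a ℓ C s lam ↔
      (M * (s.re + lam.re)) ^ 2 - (M * (s.im + lam.im)) ^ 2
        = a * (lam.re ^ 2 - lam.im ^ 2) - 2 * ℓ * lam.im - C ∧
      M * (s.re + lam.re) * (M * (s.im + lam.im)) = a * lam.re * lam.im + ℓ * lam.re := by
  unfold Dispersion
  rw [Complex.ext_iff]
  simp [pow_two]
  constructor
  · rintro ⟨h1, h2⟩
    constructor <;> linarith
  · rintro ⟨h1, h2⟩
    constructor <;> linarith

/-- The form is `|δ r₁ + b|²` for vectors with `|r₁|² = A`, `|b|² = B`, `r₁ · b = ℓ`. -/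
theorem shear_form_nonneg {A ℓ B : ℝ} (hA : 0 ≤ A) (hB : 0 ≤ B) (hℓ : ℓ ^ 2 ≤ A * B) (δ : ℝ) :
    0 ≤ A * δ ^ 2 + 2 * ℓ * δ + B := by
  rcases hA.eq_or_lt with h | h
  · have : ℓ = 0 := by
      rw [← h] at hℓ
      nlinarith [sq_nonneg ℓ]
    rw [← h, this]; linarith
  · have : 0 ≤ A * (A * δ ^ 2 + 2 * ℓ * δ + B) := by nlinarith [sq_nonneg (A * δ + ℓ)]
    exact nonneg_of_mul_nonneg_right this h

/-- No shear mode has `Re λ > 0`: with `λ = a + i δ` and `M (s + λ) = x + i y`, the relation gives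
`x² - y² = A a² - C` and `x y = a h`, where `C = |δ r₁ + b|²` and `h² ≤ A C`. Since `x ≥ M a`, this
yields `y² > C` and then `x² y² > A C a²`, a contradiction. -/
theorem not_dispersion_shear {M A ℓ B : ℝ} (hM : 0 < M) (hA : 0 ≤ A) (hAM : A < M ^ 2)
    (hB : 0 ≤ B) (hℓ : ℓ ^ 2 ≤ A * B) {s lam : ℂ} (hs : 0 ≤ s.re) (hlam : 0 < lam.re) :
    ¬ Dispersion M A ℓ B s lam := by
  rw [dispersion_iff_re_im]
  rintro ⟨h1, h2⟩
  set a := lam.re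
  set δ := lam.im
  set x := M * (s.re + a)
  set y := M * (s.im + δ)
  have hx : M * a ≤ x := by
    have := mul_nonneg hM.le hs
    simp only [x]; linarith
  have hMa : 0 < M * a := mul_pos hM hlam
  have hx2 : M ^ 2 * a ^ 2 ≤ x ^ 2 := by
    rw [← mul_pow]; exact pow_le_pow_left₀ hMa.le hx 2
  have hxA : A * a ^ 2 < x ^ 2 := lt_of_lt_of_le (by gcongr) hx2
  have hC := shear_form_nonneg hA hB hℓ δ
  set C := A * δ ^ 2 + 2 * ℓ * δ + B
  have hh : (A * δ + ℓ) ^ 2 ≤ A * C := by simp only [C]; nlinarith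
  have hy : C < y ^ 2 := by simp only [C]; nlinarith
  have hxy : x ^ 2 * y ^ 2 = a ^ 2 * (A * δ + ℓ) ^ 2 := by
    rw [← mul_pow, h2]; ring
  have e1 : x ^ 2 * C < x ^ 2 * y ^ 2 := by
    apply mul_lt_mul_of_pos_left hy
    nlinarith [sq_nonneg a]
  have e2 : A * a ^ 2 * C ≤ x ^ 2 * C := mul_le_mul_of_nonneg_right hxA.le hC
  have e3 := mul_le_mul_of_nonneg_left hh (sq_nonneg a)
  linarith

/-- The reduced Lopatinski determinant cannot vanish on an acoustic mode with `Re λ > 0`.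
A zero would have real `λ`, and the estimate for shear modes applies again. -/
theorem reduced_lopatinski_ne_zero {M A ℓ B W R : ℝ} (hM : 0 < M) (hAM : A < M ^ 2)
    (hME : M ^ 2 < 1 + A) (hB : 0 ≤ B) (hW : 0 ≤ W) (hℓ : ℓ ^ 2 ≤ A * B) (hR : 0 < R)
    {s lam : ℂ} (hs : 0 ≤ s.re) (hlam : 0 < lam.re) (h : Dispersion M (1 + A) ℓ (B + W) s lam) :
    ((1 + A - M ^ 2 : ℝ) : ℂ) * lam ^ 2 + (((M ^ 2 - A) * R - 1) * W : ℝ) ≠ 0 := by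
  intro h0
  rw [Complex.ext_iff] at h0
  simp [pow_two] at h0
  obtain ⟨h3, h4⟩ := h0
  rw [dispersion_iff_re_im] at h
  obtain ⟨h1, h2⟩ := h
  set a := lam.re
  have hδ : lam.im = 0 := by
    rcases h4 with h4 | h4
    · nlinarith
    · have : a * lam.im = 0 := by linarith
      exact (mul_eq_zero.1 this).resolve_left hlam.ne'
  rw [hδ] at h1 h2 h3
  simp only [add_zero, mul_zero, sub_zero] at h1 h2 h3
  set x := M * (s.re + a)
  set y := M * s.im
  have hMa : 0 < M * a := mul_pos hM hlam
  have hx : M * a ≤ x := by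
    have := mul_nonneg hM.le hs
    simp only [x]; linarith
  have hx2 : M ^ 2 * a ^ 2 ≤ x ^ 2 := by
    rw [← mul_pow]; exact pow_le_pow_left₀ hMa.le hx 2
  have hWpos : 0 < W := by
    rcases hW.eq_or_lt with hW | hW
    · rw [← hW] at h3
      have : 0 < (1 + A - M * M) * (a * a) := by
        apply mul_pos
        · nlinarith
        · positivity
      linarith
    · exact hW
  have hκ : 0 < (M ^ 2 - A) * R * W := by
    have : 0 < M ^ 2 - A := by linarith
    positivity
  have hy : B < y ^ 2 := by nlinarith
  have hxy : x ^ 2 * y ^ 2 = a ^ 2 * ℓ ^ 2 := by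
    rw [← mul_pow, h2]; ring
  have e1 : x ^ 2 * B < x ^ 2 * y ^ 2 := by
    apply mul_lt_mul_of_pos_left hy
    nlinarith
  have e2 : M ^ 2 * a ^ 2 * B ≤ x ^ 2 * B := mul_le_mul_of_nonneg_right hx2 hB
  have e3 := mul_le_mul_of_nonneg_left hℓ (sq_nonneg a)
  have e4 : 0 ≤ (M ^ 2 - A) * B * a ^ 2 := by
    have : 0 < M ^ 2 - A := by linarith
    positivity
  nlinarith

/-! ### The acoustic root -/

/-- Real part of the (quarter) discriminant of the acoustic dispersion relation, a quadratic
equation in `λ`, at `s = η + i ξ`. -/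
noncomputable def discRe (M E ℓ C ξ η : ℝ) : ℝ :=
  M ^ 2 * E * (η ^ 2 - ξ ^ 2) + 2 * M ^ 2 * ξ * ℓ - ℓ ^ 2 + (E - M ^ 2) * C

/-- Imaginary part of the (quarter) discriminant of the acoustic dispersion relation. -/
noncomputable def discIm (M E ℓ ξ η : ℝ) : ℝ := 2 * M ^ 2 * η * (E * ξ - ℓ)

/-- Real part of the square root of the discriminant. -/
noncomputable def sqrtDiscRe (M E ℓ C ξ η : ℝ) : ℝ :=
  √((√(discRe M E ℓ C ξ η ^ 2 + discIm M E ℓ ξ η ^ 2) + discRe M E ℓ C ξ η) / 2)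

/-- Imaginary part of the square root of the discriminant. Its sign, that of `E ξ - ℓ`, does not
depend on `η`, so that this branch of the square root is continuous up to `η = 0`. -/
noncomputable def sqrtDiscIm (M E ℓ C ξ η : ℝ) : ℝ :=
  (if ℓ ≤ E * ξ then 1 else -1) *
    √((√(discRe M E ℓ C ξ η ^ 2 + discIm M E ℓ ξ η ^ 2) - discRe M E ℓ C ξ η) / 2)

/-- The root `λ⁺` of the acoustic dispersion relation at `s = η + i ξ`, for `η ≥ 0`. -/
noncomputable def acousticRoot (M E ℓ C ξ η : ℝ) : ℂ :=
  ⟨(M ^ 2 * η + sqrtDiscRe M E ℓ C ξ η) / (E - M ^ 2),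
   (M ^ 2 * ξ - ℓ + sqrtDiscIm M E ℓ C ξ η) / (E - M ^ 2)⟩

theorem continuous_acousticRoot (M E ℓ C ξ : ℝ) : Continuous (acousticRoot M E ℓ C ξ) := by
  have h : acousticRoot M E ℓ C ξ = fun η =>
      (((M ^ 2 * η + sqrtDiscRe M E ℓ C ξ η) / (E - M ^ 2) : ℝ) : ℂ)
        + ((M ^ 2 * ξ - ℓ + sqrtDiscIm M E ℓ C ξ η) / (E - M ^ 2) : ℝ) * Complex.I := by
    funext η
    exact Complex.mk_eq_add_mul_I _ _
  rw [h]
  unfold sqrtDiscRe sqrtDiscIm discRe discIm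
  fun_prop

section

variable {M E ℓ C ξ η : ℝ}

theorem abs_discRe_le : |discRe M E ℓ C ξ η| ≤ √(discRe M E ℓ C ξ η ^ 2 + discIm M E ℓ ξ η ^ 2) :=
  Real.abs_le_sqrt (by nlinarith [sq_nonneg (discIm M E ℓ ξ η)])

theorem sqrtDisc_sq_sub :
    sqrtDiscRe M E ℓ C ξ η ^ 2 - sqrtDiscIm M E ℓ C ξ η ^ 2 = discRe M E ℓ C ξ η := by
  have h := abs_le.1 (abs_discRe_le (M := M) (E := E) (ℓ := ℓ) (C := C) (ξ := ξ) (η := η))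
  have h1 : ((if ℓ ≤ E * ξ then 1 else -1 : ℝ)) ^ 2 = 1 := by split_ifs <;> norm_num
  unfold sqrtDiscRe sqrtDiscIm
  rw [mul_pow, h1, Real.sq_sqrt (by linarith [h.1]), Real.sq_sqrt (by linarith [h.2])]
  ring

theorem sqrtDisc_mul (hη : 0 ≤ η) :
    2 * (sqrtDiscRe M E ℓ C ξ η * sqrtDiscIm M E ℓ C ξ η) = discIm M E ℓ ξ η := by
  have h := abs_le.1 (abs_discRe_le (M := M) (E := E) (ℓ := ℓ) (C := C) (ξ := ξ) (η := η))
  unfold sqrtDiscRe sqrtDiscIm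
  rw [mul_left_comm (√_), ← Real.sqrt_mul (by linarith [h.1])]
  have hs := Real.sq_sqrt (add_nonneg (sq_nonneg (discRe M E ℓ C ξ η))
    (sq_nonneg (discIm M E ℓ ξ η)))
  have e : (√(discRe M E ℓ C ξ η ^ 2 + discIm M E ℓ ξ η ^ 2) + discRe M E ℓ C ξ η) / 2
      * ((√(discRe M E ℓ C ξ η ^ 2 + discIm M E ℓ ξ η ^ 2) - discRe M E ℓ C ξ η) / 2)
      = (discIm M E ℓ ξ η / 2) ^ 2 := by linear_combination hs / 4
  rw [e, Real.sqrt_sq_eq_abs]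
  have hp : 0 ≤ M ^ 2 * η := by positivity
  unfold discIm
  split_ifs with hc
  · rw [abs_of_nonneg]
    · ring
    · have := mul_nonneg hp (sub_nonneg.2 hc)
      linarith
  · rw [abs_of_nonpos]
    · ring
    · have := mul_nonneg hp (sub_nonneg.2 (not_le.1 hc).le)
      linarith

theorem sqrtDiscRe_nonneg : 0 ≤ sqrtDiscRe M E ℓ C ξ η := Real.sqrt_nonneg _

/-- Real part of `E z = M² (E s - i ℓ)² + (E - M²) (E C - ℓ²)` for the discriminant `z`. -/
theorem mul_discRe : E * discRe M E ℓ C ξ η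
    = M ^ 2 * (E * η) ^ 2 - M ^ 2 * (E * ξ - ℓ) ^ 2 + (E - M ^ 2) * (E * C - ℓ ^ 2) := by
  unfold discRe; ring

/-- This bound puts the second root of the acoustic relation into the left half-plane. -/
theorem le_sqrtDiscRe (hM : 0 < M) (hME : M ^ 2 < E) (hN : ℓ ^ 2 ≤ E * C) (hη : 0 < η) :
    M ^ 2 * η ≤ sqrtDiscRe M E ℓ C ξ η := by
  by_contra! hlt
  have h0 := sqrtDiscRe_nonneg (M := M) (E := E) (ℓ := ℓ) (C := C) (ξ := ξ) (η := η)
  have h1 := sqrtDisc_sq_sub (M := M) (E := E) (ℓ := ℓ) (C := C) (ξ := ξ) (η := η)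
  have h2 := sqrtDisc_mul (M := M) (E := E) (ℓ := ℓ) (C := C) (ξ := ξ) hη.le
  have h3 := mul_discRe (M := M) (E := E) (ℓ := ℓ) (C := C) (ξ := ξ) (η := η)
  rw [← h1] at h3
  unfold discIm at h2
  set x := sqrtDiscRe M E ℓ C ξ η
  set y := sqrtDiscIm M E ℓ C ξ η
  set t := E * ξ - ℓ
  have hM2 : 0 < M ^ 2 := by positivity
  have hE : 0 < E := hM2.trans hME
  have hp : 0 < M ^ 2 * η := by positivity
  have hxy : x * y = M ^ 2 * η * t := by linarith
  have hx2 : x ^ 2 < (M ^ 2 * η) ^ 2 := pow_lt_pow_left₀ hlt h0 two_ne_zero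
  have hty : t ^ 2 ≤ y ^ 2 := by
    have e : x ^ 2 * y ^ 2 = (M ^ 2 * η) ^ 2 * t ^ 2 := by rw [← mul_pow, hxy]; ring
    have e1 : x ^ 2 * y ^ 2 ≤ (M ^ 2 * η) ^ 2 * y ^ 2 :=
      mul_le_mul_of_nonneg_right hx2.le (sq_nonneg y)
    rw [e] at e1
    exact le_of_mul_le_mul_left e1 (by positivity)
  have e1 : E * x ^ 2 < E * (M ^ 2 * η) ^ 2 := mul_lt_mul_of_pos_left hx2 hE
  have e2 : E * t ^ 2 ≤ E * y ^ 2 := mul_le_mul_of_nonneg_left hty hE.le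
  have e3 : M ^ 2 * t ^ 2 ≤ E * t ^ 2 := mul_le_mul_of_nonneg_right hME.le (sq_nonneg t)
  have e4 : 0 ≤ (E - M ^ 2) * (E * C - ℓ ^ 2) := mul_nonneg (by linarith) (by linarith)
  have e5 : 0 ≤ (E - M ^ 2) * (M ^ 2 * E * η ^ 2) := mul_nonneg (by linarith) (by positivity)
  nlinarith

/-- The acoustic dispersion relation, after completing the square. -/
theorem dispersion_iff_sq (hME : M ^ 2 < E) {s lam : ℂ} :
    Dispersion M E ℓ C s lam ↔
      (((E - M ^ 2 : ℝ) : ℂ) * lam - (M ^ 2 * s - Complex.I * ℓ)) ^ 2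
        = (M ^ 2 * s - Complex.I * ℓ) ^ 2 + (E - M ^ 2 : ℝ) * (M ^ 2 * s ^ 2 + C) := by
  have hβ : ((E - M ^ 2 : ℝ) : ℂ) ≠ 0 := by
    rw [Complex.ofReal_ne_zero]; linarith
  unfold Dispersion
  constructor
  · intro h
    push_cast
    linear_combination (-(E - M ^ 2 : ℂ)) * h
  · intro h
    apply mul_left_cancel₀ hβ
    push_cast at h ⊢
    linear_combination -h

theorem acousticRoot_spec (hME : M ^ 2 < E) :
    ((E - M ^ 2 : ℝ) : ℂ) * acousticRoot M E ℓ C ξ η - (M ^ 2 * (η + Complex.I * ξ) - Complex.I * ℓ)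
      = ⟨sqrtDiscRe M E ℓ C ξ η, sqrtDiscIm M E ℓ C ξ η⟩ := by
  have hβ : E - M ^ 2 ≠ 0 := by linarith
  rw [pow_two] at hβ
  apply Complex.ext
  · simp [acousticRoot, pow_two, mul_div_cancel₀ _ hβ]
  · simp [acousticRoot, pow_two, mul_div_cancel₀ _ hβ]

theorem sqrtDisc_sq (hη : 0 ≤ η) :
    (⟨sqrtDiscRe M E ℓ C ξ η, sqrtDiscIm M E ℓ C ξ η⟩ : ℂ) ^ 2
      = (M ^ 2 * (η + Complex.I * ξ) - Complex.I * ℓ) ^ 2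
        + (E - M ^ 2 : ℝ) * (M ^ 2 * (η + Complex.I * ξ) ^ 2 + C) := by
  have h1 := sqrtDisc_sq_sub (M := M) (E := E) (ℓ := ℓ) (C := C) (ξ := ξ) (η := η)
  have h2 := sqrtDisc_mul (M := M) (E := E) (ℓ := ℓ) (C := C) (ξ := ξ) hη
  unfold discRe at h1
  unfold discIm at h2
  apply Complex.ext
  · simp [pow_two]
    linarith
  · simp [pow_two]
    linarith

theorem dispersion_acousticRoot (hME : M ^ 2 < E) (hη : 0 ≤ η) :
    Dispersion M E ℓ C (η + Complex.I * ξ) (acousticRoot M E ℓ C ξ η) := by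
  rw [dispersion_iff_sq hME, acousticRoot_spec hME, sqrtDisc_sq hη]

theorem acousticRoot_re_nonneg (hME : M ^ 2 < E) (hη : 0 ≤ η) :
    0 ≤ (acousticRoot M E ℓ C ξ η).re := by
  have h0 := sqrtDiscRe_nonneg (M := M) (E := E) (ℓ := ℓ) (C := C) (ξ := ξ) (η := η)
  have : 0 < E - M ^ 2 := by linarith
  simp only [acousticRoot]
  positivity

theorem acousticRoot_re_pos (hM : 0 < M) (hME : M ^ 2 < E) (hη : 0 < η) :
    0 < (acousticRoot M E ℓ C ξ η).re := by
  have h0 := sqrtDiscRe_nonneg (M := M) (E := E) (ℓ := ℓ) (C := C) (ξ := ξ) (η := η)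
  have : 0 < E - M ^ 2 := by linarith
  simp only [acousticRoot]
  positivity

theorem eq_acousticRoot (hM : 0 < M) (hME : M ^ 2 < E) (hN : ℓ ^ 2 ≤ E * C) (hη : 0 < η) {μ : ℂ}
    (h : Dispersion M E ℓ C (η + Complex.I * ξ) μ) (hμ : 0 < μ.re) :
    μ = acousticRoot M E ℓ C ξ η := by
  have hβ : 0 < E - M ^ 2 := by linarith
  have hβ' : ((E - M ^ 2 : ℝ) : ℂ) ≠ 0 := by
    rw [Complex.ofReal_ne_zero]; exact hβ.ne'
  rw [dispersion_iff_sq hME, ← sqrtDisc_sq hη.le, sq_eq_sq_iff_eq_or_eq_neg] at h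
  rcases h with h | h
  · rw [← acousticRoot_spec hME] at h
    exact mul_left_cancel₀ hβ' (sub_left_injective h)
  · -- The other root has nonpositive real part.
    exfalso
    have h1 := congrArg Complex.re h
    have h2 := le_sqrtDiscRe (ξ := ξ) hM hME hN hη
    have h3 := mul_pos hβ hμ
    simp [pow_two] at h1
    nlinarith

end

/-! ### The kernel of the symbol -/

/-- The symbol `(λ, i ω₂, i ω₃)` of the gradient. -/
def gradSymbol (lam : ℂ) (ω₂ ω₃ : ℝ) : Fin 3 → ℂ := ![lam, Complex.I * ω₂, Complex.I * ω₃]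

/-- The symbol of the derivative `𝓕_j · ∇` along the `j`-th column of `𝓕`. -/
def elasticSymbol (𝓕 : Matrix (Fin 3) (Fin 3) ℝ) (lam : ℂ) (ω₂ ω₃ : ℝ) (j : Fin 3) : ℂ :=
  lam * 𝓕 0 j + Complex.I * (ω₂ * 𝓕 1 j + ω₃ * 𝓕 2 j)

/-- The acoustic kernel vector, whose velocity is along the symbol `k` of the gradient; it is scaled
so that no division by `s + λ` occurs. -/
def acousticVec (𝓕 : Matrix (Fin 3) (Fin 3) ℝ) (s lam : ℂ) (ω₂ ω₃ : ℝ) : Idx → ℂ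
  | Sum.inl _ => -(lam ^ 2 - (ω₂ ^ 2 + ω₃ ^ 2))
  | Sum.inr (Sum.inl k) => (s + lam) * gradSymbol lam ω₂ ω₃ k
  | Sum.inr (Sum.inr (k, j)) => elasticSymbol 𝓕 lam ω₂ ω₃ j * gradSymbol lam ω₂ ω₃ k

section

variable {M R : ℝ} {𝓕 : Matrix (Fin 3) (Fin 3) ℝ} {s lam : ℂ} {ω₂ ω₃ : ℝ} {X U : Idx → ℂ}

theorem dotProduct_self_nonneg (a : Fin 3 → ℝ) : 0 ≤ a ⬝ᵥ a :=
  Finset.sum_nonneg fun _ _ => mul_self_nonneg _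

theorem symbol_mulVec_ip : (symbol M 𝓕 s lam ω₂ ω₃ *ᵥ X) ip
    = (s + lam) * X ip + ∑ k, gradSymbol lam ω₂ ω₃ k * X (iv k) := by
  simp [symbol, coeffA, coeffA₀, coeffB, mulVec, dotProduct, Fintype.sum_sum_type,
    Fin.sum_univ_three, gradSymbol, Matrix.diagonal_apply]

theorem symbol_mulVec_iv (k : Fin 3) : (symbol M 𝓕 s lam ω₂ ω₃ *ᵥ X) (iv k)
    = M ^ 2 * (s + lam) * X (iv k) + gradSymbol lam ω₂ ω₃ k * X ip
      - ∑ j, elasticSymbol 𝓕 lam ω₂ ω₃ j * X (iF k j) := by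
  fin_cases k <;>
  simp [symbol, coeffA, coeffA₀, coeffB, mulVec, dotProduct, Fintype.sum_sum_type,
    Fin.sum_univ_three, Fintype.sum_prod_type, gradSymbol, elasticSymbol, Matrix.diagonal_apply] <;>
  ring

theorem symbol_mulVec_iF (k j : Fin 3) : (symbol M 𝓕 s lam ω₂ ω₃ *ᵥ X) (iF k j)
    = (s + lam) * X (iF k j) - elasticSymbol 𝓕 lam ω₂ ω₃ j * X (iv k) := by
  fin_cases k <;> fin_cases j <;>
  simp [symbol, coeffA, coeffA₀, coeffB, mulVec, dotProduct, Fintype.sum_sum_type,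
    Fin.sum_univ_three, Fintype.sum_prod_type, elasticSymbol, Matrix.diagonal_apply] <;>
  ring

theorem coeffA_mulVec_ip : ((coeffA M 𝓕 0).map Complex.ofReal *ᵥ U) ip = U ip + U (iv 0) := by
  simp [coeffA, coeffA₀, coeffB, mulVec, dotProduct, Fintype.sum_sum_type,
    Fin.sum_univ_three, Matrix.diagonal_apply]

theorem coeffA_mulVec_iv (k : Fin 3) : ((coeffA M 𝓕 0).map Complex.ofReal *ᵥ U) (iv k)
    = M ^ 2 * U (iv k) + (if k = 0 then U ip else 0) - ∑ j, 𝓕 0 j * U (iF k j) := by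
  fin_cases k <;>
  simp [coeffA, coeffA₀, coeffB, mulVec, dotProduct, Fintype.sum_sum_type,
    Fin.sum_univ_three, Fintype.sum_prod_type, Matrix.diagonal_apply] <;>
  ring

theorem coeffA_mulVec_iF (k j : Fin 3) : ((coeffA M 𝓕 0).map Complex.ofReal *ᵥ U) (iF k j)
    = U (iF k j) - 𝓕 0 j * U (iv k) := by
  fin_cases k <;> fin_cases j <;>
  simp [coeffA, coeffA₀, coeffB, mulVec, dotProduct, Fintype.sum_sum_type,
    Fin.sum_univ_three, Fintype.sum_prod_type, Matrix.diagonal_apply] <;>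
  ring

theorem coeffB_transpose (j : Fin 3) : (coeffB 𝓕 j)ᵀ = coeffB 𝓕 j := by
  ext a b
  rcases a with a | a | ⟨a, a'⟩ <;> rcases b with b | b | ⟨b, b'⟩ <;>
    simp [coeffB, eq_comm]

theorem coeffA_transpose (j : Fin 3) : (coeffA M 𝓕 j)ᵀ = coeffA M 𝓕 j := by
  unfold coeffA
  rw [transpose_add, coeffB_transpose]
  split_ifs <;> simp [coeffA₀]

theorem symbol_transpose : (symbol M 𝓕 s lam ω₂ ω₃)ᵀ = symbol M 𝓕 s lam ω₂ ω₃ := by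
  unfold symbol
  simp only [transpose_add, transpose_smul, ← transpose_map, coeffA_transpose]
  simp [coeffA₀]

theorem sum_gradSymbol_sq :
    ∑ k, gradSymbol lam ω₂ ω₃ k * gradSymbol lam ω₂ ω₃ k = lam ^ 2 - (ω₂ ^ 2 + ω₃ ^ 2) := by
  simp [gradSymbol, Fin.sum_univ_three]
  linear_combination (ω₂ ^ 2 + ω₃ ^ 2 : ℂ) * Complex.I_sq

theorem sum_elasticSymbol_sq :
    ∑ j, elasticSymbol 𝓕 lam ω₂ ω₃ j * elasticSymbol 𝓕 lam ω₂ ω₃ j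
      = (𝓕 0 ⬝ᵥ 𝓕 0 : ℝ) * lam ^ 2
        + 2 * Complex.I * (𝓕 0 ⬝ᵥ (ω₂ • 𝓕 1 + ω₃ • 𝓕 2) : ℝ) * lam
        - ((ω₂ • 𝓕 1 + ω₃ • 𝓕 2) ⬝ᵥ (ω₂ • 𝓕 1 + ω₃ • 𝓕 2) : ℝ) := by
  simp [elasticSymbol, Fin.sum_univ_three, dotProduct]
  ring_nf
  simp only [Complex.I_sq]
  ring

/-- On the kernel of the symbol, pressure and deformation are expressed by the velocity, which solves
`(M² T² - g·g) v = (k·v) k`, where `T = s + λ`. -/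
theorem velocity_eq_of_symbol_mulVec_eq_zero (h : symbol M 𝓕 s lam ω₂ ω₃ *ᵥ X = 0) (k : Fin 3) :
    (M ^ 2 * (s + lam) ^ 2
        - ∑ j, elasticSymbol 𝓕 lam ω₂ ω₃ j * elasticSymbol 𝓕 lam ω₂ ω₃ j) * X (iv k)
      = gradSymbol lam ω₂ ω₃ k * ∑ k', gradSymbol lam ω₂ ω₃ k' * X (iv k') := by
  have hp := congrFun h ip
  have hv := congrFun h (iv k)
  have hF := fun j => congrFun h (iF k j)
  rw [symbol_mulVec_ip] at hp
  rw [symbol_mulVec_iv] at hv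
  simp only [symbol_mulVec_iF] at hF
  have h0 := hF 0
  have h1 := hF 1
  have h2 := hF 2
  simp only [Pi.zero_apply, Fin.sum_univ_three] at *
  linear_combination (s + lam) * hv - gradSymbol lam ω₂ ω₃ k * hp
    + elasticSymbol 𝓕 lam ω₂ ω₃ 0 * h0 + elasticSymbol 𝓕 lam ω₂ ω₃ 1 * h1
    + elasticSymbol 𝓕 lam ω₂ ω₃ 2 * h2

theorem eq_zero_of_velocity_eq_zero (hT : s + lam ≠ 0) (h : symbol M 𝓕 s lam ω₂ ω₃ *ᵥ X = 0)
    (hv : ∀ k, X (iv k) = 0) : X = 0 := by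
  have hp := congrFun h ip
  have hF := fun k j => congrFun h (iF k j)
  rw [symbol_mulVec_ip] at hp
  simp only [symbol_mulVec_iF] at hF
  simp only [hv, Pi.zero_apply, mul_zero, Finset.sum_const_zero, add_zero, sub_zero, mul_eq_zero,
    hT, false_or] at hp hF
  funext a
  rcases a with a | k | ⟨k, j⟩
  · exact hp
  · exact hv k
  · exact hF k j

/-- If the symbol is singular and `s + λ ≠ 0`, then `λ` solves the dispersion relation of the shear
waves (velocity orthogonal to `k`) or that of the acoustic waves. -/
theorem dispersion_of_det_symbol_eq_zero (hT : s + lam ≠ 0)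
    (hdet : (symbol M 𝓕 s lam ω₂ ω₃).det = 0) :
    Dispersion M (𝓕 0 ⬝ᵥ 𝓕 0) (𝓕 0 ⬝ᵥ (ω₂ • 𝓕 1 + ω₃ • 𝓕 2))
      ((ω₂ • 𝓕 1 + ω₃ • 𝓕 2) ⬝ᵥ (ω₂ • 𝓕 1 + ω₃ • 𝓕 2)) s lam ∨
    Dispersion M (1 + 𝓕 0 ⬝ᵥ 𝓕 0) (𝓕 0 ⬝ᵥ (ω₂ • 𝓕 1 + ω₃ • 𝓕 2))
      ((ω₂ • 𝓕 1 + ω₃ • 𝓕 2) ⬝ᵥ (ω₂ • 𝓕 1 + ω₃ • 𝓕 2) + (ω₂ ^ 2 + ω₃ ^ 2)) s lam := by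
  obtain ⟨X, hX, h⟩ := Matrix.exists_mulVec_eq_zero_iff.2 hdet
  have hv := velocity_eq_of_symbol_mulVec_eq_zero h
  by_cases hkv : ∑ k', gradSymbol lam ω₂ ω₃ k' * X (iv k') = 0
  · left
    by_contra hne
    apply hX
    apply eq_zero_of_velocity_eq_zero hT h
    intro k
    have := hv k
    rw [hkv, mul_zero, mul_eq_zero] at this
    refine this.resolve_left fun h0 => hne ?_
    rw [sum_elasticSymbol_sq] at h0
    exact sub_eq_zero.1 h0
  · right
    have h3 : (M ^ 2 * (s + lam) ^ 2
        - ∑ j, elasticSymbol 𝓕 lam ω₂ ω₃ j * elasticSymbol 𝓕 lam ω₂ ω₃ j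
        - ∑ k, gradSymbol lam ω₂ ω₃ k * gradSymbol lam ω₂ ω₃ k)
          * ∑ k', gradSymbol lam ω₂ ω₃ k' * X (iv k') = 0 := by
      have h0 := hv 0
      have h1 := hv 1
      have h2 := hv 2
      simp only [Fin.sum_univ_three] at *
      linear_combination gradSymbol lam ω₂ ω₃ 0 * h0 + gradSymbol lam ω₂ ω₃ 1 * h1
        + gradSymbol lam ω₂ ω₃ 2 * h2
    have h4 := (mul_eq_zero.1 h3).resolve_right hkv
    rw [sum_elasticSymbol_sq, sum_gradSymbol_sq] at h4
    unfold Dispersion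
    push_cast at h4 ⊢
    linear_combination h4

/-- The acoustic dispersion relation in terms of the symbols of the derivatives. -/
theorem dispersion_acoustic_iff :
    Dispersion M (1 + 𝓕 0 ⬝ᵥ 𝓕 0) (𝓕 0 ⬝ᵥ (ω₂ • 𝓕 1 + ω₃ • 𝓕 2))
      ((ω₂ • 𝓕 1 + ω₃ • 𝓕 2) ⬝ᵥ (ω₂ • 𝓕 1 + ω₃ • 𝓕 2) + (ω₂ ^ 2 + ω₃ ^ 2)) s lam ↔
    M ^ 2 * (s + lam) ^ 2
        - ∑ j, elasticSymbol 𝓕 lam ω₂ ω₃ j * elasticSymbol 𝓕 lam ω₂ ω₃ j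
      = lam ^ 2 - (ω₂ ^ 2 + ω₃ ^ 2) := by
  rw [sum_elasticSymbol_sq]
  unfold Dispersion
  push_cast
  constructor <;> intro h <;> linear_combination h

theorem symbol_mulVec_acousticVec
    (h : M ^ 2 * (s + lam) ^ 2
        - ∑ j, elasticSymbol 𝓕 lam ω₂ ω₃ j * elasticSymbol 𝓕 lam ω₂ ω₃ j
      = lam ^ 2 - (ω₂ ^ 2 + ω₃ ^ 2)) :
    symbol M 𝓕 s lam ω₂ ω₃ *ᵥ acousticVec 𝓕 s lam ω₂ ω₃ = 0 := by
  funext a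
  rcases a with ⟨⟩ | k | ⟨k, j⟩
  · have := sum_gradSymbol_sq (lam := lam) (ω₂ := ω₂) (ω₃ := ω₃)
    rw [symbol_mulVec_ip]
    simp only [acousticVec, Pi.zero_apply, Fin.sum_univ_three] at *
    linear_combination (s + lam) * this
  · rw [symbol_mulVec_iv]
    simp only [acousticVec, Pi.zero_apply, Fin.sum_univ_three] at *
    linear_combination gradSymbol lam ω₂ ω₃ k * h
  · rw [symbol_mulVec_iF]
    simp only [acousticVec, Pi.zero_apply]
    ring

theorem acousticVec_ne_zero (hk : lam ^ 2 - (ω₂ ^ 2 + ω₃ ^ 2 : ℂ) ≠ 0) :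
    acousticVec 𝓕 s lam ω₂ ω₃ ≠ 0 := fun h => hk (neg_eq_zero.1 (congrFun h ip))

/-- The kernel of the symbol at an acoustic mode is spanned by the acoustic vector. -/
theorem eq_smul_acousticVec (hT : s + lam ≠ 0) (hk : lam ^ 2 - (ω₂ ^ 2 + ω₃ ^ 2 : ℂ) ≠ 0)
    (h : M ^ 2 * (s + lam) ^ 2
        - ∑ j, elasticSymbol 𝓕 lam ω₂ ω₃ j * elasticSymbol 𝓕 lam ω₂ ω₃ j
      = lam ^ 2 - (ω₂ ^ 2 + ω₃ ^ 2))
    (hX : symbol M 𝓕 s lam ω₂ ω₃ *ᵥ X = 0) :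
    ∃ c : ℂ, X = c • acousticVec 𝓕 s lam ω₂ ω₃ := by
  have hv := velocity_eq_of_symbol_mulVec_eq_zero hX
  rw [h] at hv
  refine ⟨(∑ k', gradSymbol lam ω₂ ω₃ k' * X (iv k')) /
    ((s + lam) * (lam ^ 2 - (ω₂ ^ 2 + ω₃ ^ 2))), ?_⟩
  rw [← sub_eq_zero]
  apply eq_zero_of_velocity_eq_zero (M := M) (𝓕 := 𝓕) (ω₂ := ω₂) (ω₃ := ω₃) hT
  · rw [mulVec_sub, mulVec_smul, symbol_mulVec_acousticVec h, hX, smul_zero, sub_zero]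
  · intro k
    have := hv k
    simp only [Pi.sub_apply, Pi.smul_apply, acousticVec, smul_eq_mul]
    field_simp
    linear_combination this

/-! ### The Lopatinski determinant -/

/-- The pairing of a solution of the boundary conditions with the acoustic vector. Up to the factor
`(1 - R) φ / R`, the vector `𝓐₁ U₀` has pressure component `-s`, velocity
`(M² s - i ℓ, -(M² - M₁²) R i ω')`, first deformation row `s r₁ - i b` and no other components. -/
theorem boundary_pairing (hM : 0 < M) (hR : 0 < R) (hME : M ^ 2 < 1 + 𝓕 0 ⬝ᵥ 𝓕 0)
    (h : Dispersion M (1 + 𝓕 0 ⬝ᵥ 𝓕 0) (𝓕 0 ⬝ᵥ (ω₂ • 𝓕 1 + ω₃ • 𝓕 2))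
      ((ω₂ • 𝓕 1 + ω₃ • 𝓕 2) ⬝ᵥ (ω₂ • 𝓕 1 + ω₃ • 𝓕 2) + (ω₂ ^ 2 + ω₃ ^ 2)) s lam)
    {φ : ℂ}
    (hv1 : U (iv 0) + d₀ M 𝓕 * U ip
        - 1 / ((M : ℂ) ^ 2 * R) * (ℓ₂ 𝓕 * U (iv 1) + ℓ₃ 𝓕 * U (iv 2)) = 0)
    (hp : a₀ M R 𝓕 * U ip + (1 - (R : ℂ)) * (dStar M 𝓕 s ω₂ ω₃ * φ) = 0)
    (hv2 : U (iv 1) + (1 - (R : ℂ)) * (Complex.I * ω₂ * φ) = 0)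
    (hv3 : U (iv 2) + (1 - (R : ℂ)) * (Complex.I * ω₃ * φ) = 0)
    (hF1 : ∀ j : Fin 3, U (iF 0 j) + 𝓕 0 j * U ip
        - 1 / (R : ℂ) * (𝓕 1 j * U (iv 1) + 𝓕 2 j * U (iv 2)) = 0)
    (hF2 : ∀ j : Fin 3, U (iF 1 j) - 𝓕 0 j * U (iv 1) = 0)
    (hF3 : ∀ j : Fin 3, U (iF 2 j) - 𝓕 0 j * U (iv 2) = 0) :
    R * (((coeffA M 𝓕 0).map Complex.ofReal *ᵥ U) ⬝ᵥ acousticVec 𝓕 s lam ω₂ ω₃)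
      = (1 - R) * φ * (s + lam) * (((1 + 𝓕 0 ⬝ᵥ 𝓕 0 - M ^ 2 : ℝ) : ℂ) * lam ^ 2
        + (((M ^ 2 - 𝓕 0 ⬝ᵥ 𝓕 0) * R - 1) * (ω₂ ^ 2 + ω₃ ^ 2) : ℝ)) := by
  have hE : MStar 𝓕 ^ 2 = 1 + 𝓕 0 ⬝ᵥ 𝓕 0 := by
    have := dotProduct_self_nonneg (𝓕 0)
    rw [MStar, vnorm, Real.sq_sqrt this, Real.sq_sqrt (by linarith)]
  have hβ : β M 𝓕 ^ 2 = 1 + 𝓕 0 ⬝ᵥ 𝓕 0 - M ^ 2 := by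
    rw [β, hE, Real.sq_sqrt (by linarith)]
  have hMc : (M : ℂ) ≠ 0 := by exact_mod_cast hM.ne'
  have hRc : (R : ℂ) ≠ 0 := by exact_mod_cast hR.ne'
  set A : ℝ := 𝓕 0 ⬝ᵥ 𝓕 0 with hA
  set u : ℂ := (1 - R) * φ with hu
  have e2 : U (iv 1) = -(Complex.I * ω₂ * u) := by linear_combination hv2
  have e3 : U (iv 2) = -(Complex.I * ω₃ * u) := by linear_combination hv3
  set ℓ : ℂ := ω₂ * ℓ₂ 𝓕 + ω₃ * ℓ₃ 𝓕 with hℓ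
  -- The pressure is eliminated by means of the front equation.
  have ep : (1 + A - M ^ 2 : ℂ) * R * U ip = 2 * (M ^ 2 * s - Complex.I * ℓ) * u := by
    have : (a₀ M R 𝓕 : ℂ) = -((1 + A - M ^ 2) * R) / (2 * M ^ 2) := by
      rw [a₀, hβ]; push_cast; ring
    rw [this, dStar] at hp
    field_simp at hp
    rw [hu, hℓ]
    linear_combination -hp
  have ed : (d₀ M 𝓕 : ℂ) = (1 + A + M ^ 2) / (2 * M ^ 2) := by
    rw [d₀, hE]; push_cast; ring
  have e1 : 2 * M ^ 2 * R * U (iv 0) = -((1 + A + M ^ 2) * R * U ip) - 2 * Complex.I * ℓ * u := by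
    rw [ed, e2, e3] at hv1
    field_simp at hv1
    rw [hℓ]
    linear_combination hv1
  have e4 : R * (U ip + U (iv 0)) = -(s * u) := by
    apply mul_left_cancel₀ (pow_ne_zero 2 hMc)
    linear_combination e1 / 2 - ep / 2
  have eF : ∀ j : Fin 3, R * U (iF 0 j)
      = -(R * 𝓕 0 j * U ip) - Complex.I * (ω₂ * 𝓕 1 j + ω₃ * 𝓕 2 j) * u := by
    intro j
    have := hF1 j
    rw [e2, e3] at this
    field_simp at this
    linear_combination this
  have hAc : (A : ℂ) = 𝓕 0 0 ^ 2 + 𝓕 0 1 ^ 2 + 𝓕 0 2 ^ 2 := by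
    rw [hA]; simp [dotProduct, Fin.sum_univ_three]; ring
  have hℓc : ℓ = 𝓕 0 0 * (ω₂ * 𝓕 1 0 + ω₃ * 𝓕 2 0) + 𝓕 0 1 * (ω₂ * 𝓕 1 1 + ω₃ * 𝓕 2 1)
      + 𝓕 0 2 * (ω₂ * 𝓕 1 2 + ω₃ * 𝓕 2 2) := by
    rw [hℓ]; simp [ℓ₂, ℓ₃, dotProduct, Fin.sum_univ_three]; ring
  -- The components of `R 𝓐₁ U₀`.
  have c0 : R * ((coeffA M 𝓕 0).map Complex.ofReal *ᵥ U) ip = -(s * u) := by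
    rw [coeffA_mulVec_ip, e4]
  have c1 : R * ((coeffA M 𝓕 0).map Complex.ofReal *ᵥ U) (iv 0)
      = (M ^ 2 * s - Complex.I * ℓ) * u := by
    rw [coeffA_mulVec_iv]
    simp only [if_true, Fin.sum_univ_three]
    have f0 := eF 0
    have f1 := eF 1
    have f2 := eF 2
    rw [hAc] at e1 ep
    linear_combination e1 / 2 + ep / 2 - 𝓕 0 0 * f0 - 𝓕 0 1 * f1 - 𝓕 0 2 * f2
      - Complex.I * u * hℓc
  have c2 : R * ((coeffA M 𝓕 0).map Complex.ofReal *ᵥ U) (iv 1)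
      = -((M ^ 2 - A) * R * (Complex.I * ω₂ * u)) := by
    rw [coeffA_mulVec_iv]
    simp only [Fin.sum_univ_three]
    have f0 := hF2 0
    have f1 := hF2 1
    have f2 := hF2 2
    rw [e2] at f0 f1 f2
    rw [hAc, e2]
    simp
    linear_combination R * (- 𝓕 0 0 * f0 - 𝓕 0 1 * f1 - 𝓕 0 2 * f2)
  have c3 : R * ((coeffA M 𝓕 0).map Complex.ofReal *ᵥ U) (iv 2)
      = -((M ^ 2 - A) * R * (Complex.I * ω₃ * u)) := by
    rw [coeffA_mulVec_iv]
    simp only [Fin.sum_univ_three]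
    have f0 := hF3 0
    have f1 := hF3 1
    have f2 := hF3 2
    rw [e3] at f0 f1 f2
    rw [hAc, e3]
    simp
    linear_combination R * (- 𝓕 0 0 * f0 - 𝓕 0 1 * f1 - 𝓕 0 2 * f2)
  have c4 : ∀ j, R * ((coeffA M 𝓕 0).map Complex.ofReal *ᵥ U) (iF 0 j)
      = (𝓕 0 j * s - Complex.I * (ω₂ * 𝓕 1 j + ω₃ * 𝓕 2 j)) * u := by
    intro j
    rw [coeffA_mulVec_iF]
    linear_combination eF j - 𝓕 0 j * e4
  have c5 : ∀ j, ((coeffA M 𝓕 0).map Complex.ofReal *ᵥ U) (iF 1 j) = 0 := by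
    intro j; rw [coeffA_mulVec_iF, hF2]
  have c6 : ∀ j, ((coeffA M 𝓕 0).map Complex.ofReal *ᵥ U) (iF 2 j) = 0 := by
    intro j; rw [coeffA_mulVec_iF, hF3]
  have hD : (M : ℂ) ^ 2 * (s + lam) ^ 2 = (1 + A) * lam ^ 2 + 2 * Complex.I * ℓ * lam
      - (((ω₂ * 𝓕 1 0 + ω₃ * 𝓕 2 0) ^ 2 + (ω₂ * 𝓕 1 1 + ω₃ * 𝓕 2 1) ^ 2
        + (ω₂ * 𝓕 1 2 + ω₃ * 𝓕 2 2) ^ 2) + (ω₂ ^ 2 + ω₃ ^ 2)) := by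
    have := h
    unfold Dispersion at this
    rw [hℓc]
    simp [dotProduct, Fin.sum_univ_three] at this ⊢
    linear_combination this
  set Y := (coeffA M 𝓕 0).map Complex.ofReal *ᵥ U
  have hsum : R * (Y ⬝ᵥ acousticVec 𝓕 s lam ω₂ ω₃)
      = (R * Y ip) * (-(lam ^ 2 - (ω₂ ^ 2 + ω₃ ^ 2)))
        + (R * Y (iv 0)) * ((s + lam) * lam)
        + (R * Y (iv 1)) * ((s + lam) * (Complex.I * ω₂))
        + (R * Y (iv 2)) * ((s + lam) * (Complex.I * ω₃))
        + ((R * Y (iF 0 0)) * (elasticSymbol 𝓕 lam ω₂ ω₃ 0 * lam)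
          + (R * Y (iF 0 1)) * (elasticSymbol 𝓕 lam ω₂ ω₃ 1 * lam)
          + (R * Y (iF 0 2)) * (elasticSymbol 𝓕 lam ω₂ ω₃ 2 * lam)) := by
    simp [dotProduct, Fintype.sum_sum_type, Fin.sum_univ_three, Fintype.sum_prod_type,
      acousticVec, gradSymbol, c5, c6]
    ring
  rw [hsum, c0, c1, c2, c3, c4, c4, c4]
  simp only [elasticSymbol]
  push_cast
  rw [hAc] at hD ⊢
  rw [hℓc] at hD ⊢
  linear_combination u * lam * hD + (Complex.I_sq) *
    (-((M ^ 2 - (𝓕 0 0 ^ 2 + 𝓕 0 1 ^ 2 + 𝓕 0 2 ^ 2)) * R * (ω₂ ^ 2 + ω₃ ^ 2) * u * (s + lam))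
      - u * lam * ((ω₂ * 𝓕 1 0 + ω₃ * 𝓕 2 0) ^ 2 + (ω₂ * 𝓕 1 1 + ω₃ * 𝓕 2 1) ^ 2
        + (ω₂ * 𝓕 1 2 + ω₃ * 𝓕 2 2) ^ 2))

end

/-- At an acoustic mode with `Re s ≥ 0`, `Re λ ≥ 0` and nonzero frequency, the kernel of the symbol is
one-dimensional: neither `s + λ` nor `k · k = λ² - |ω'|²` vanishes. -/
theorem acoustic_mode_nondegenerate {M A ℓ B W : ℝ} (hM : 0 < M) (hA : 0 ≤ A) (hAM : A < M ^ 2)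
    (hB : 0 ≤ B) (hW : 0 ≤ W) (hℓ : ℓ ^ 2 ≤ A * B) (hBW : W = 0 → B = 0) {s lam : ℂ}
    (hs : 0 ≤ s.re) (hlam : 0 ≤ lam.re) (hsW : s ≠ 0 ∨ W ≠ 0)
    (h : Dispersion M (1 + A) ℓ (B + W) s lam) : s + lam ≠ 0 ∧ lam ^ 2 - (W : ℂ) ≠ 0 := by
  rcases hlam.eq_or_lt with h0 | h0
  · have hl : lam = lam.im * Complex.I := by
      apply Complex.ext <;> simp [← h0]
    set δ := lam.im
    -- A degenerate mode has zero frequency.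
    have key : δ = 0 → W = 0 → False := by
      intro h1 h2
      have h3 := hBW h2
      have h4 : ℓ = 0 := by
        rw [h3, mul_zero] at hℓ
        exact pow_eq_zero_iff two_ne_zero |>.1 (le_antisymm hℓ (sq_nonneg ℓ))
      rw [h1] at hl
      unfold Dispersion at h
      simp [hl, h2, h3, h4, hM.ne'] at h
      rcases hsW with hs | hs
      · exact hs h
      · exact hs h2
    constructor
    · intro hT
      unfold Dispersion at h
      rw [hT, hl] at h
      have h1 := congrArg Complex.re h
      simp [pow_two] at h1
      have h2 := shear_form_nonneg hA hB hℓ δ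
      have h3 : δ * δ = 0 ∧ W = 0 := by
        constructor <;> nlinarith [mul_self_nonneg δ]
      exact key (mul_self_eq_zero.1 h3.1) h3.2
    · intro hk
      rw [hl, mul_pow, Complex.I_sq] at hk
      have h1 := congrArg Complex.re hk
      simp [pow_two] at h1
      have h3 : δ * δ = 0 ∧ W = 0 := by
        constructor <;> nlinarith [mul_self_nonneg δ]
      exact key (mul_self_eq_zero.1 h3.1) h3.2
  · constructor
    · intro hT
      have := congrArg Complex.re hT
      simp at this
      linarith
    · intro hk
      refine not_dispersion_shear hM hA hAM hB hℓ hs h0 ?_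
      unfold Dispersion at h ⊢
      push_cast at h
      linear_combination h + hk

section

variable {M R : ℝ} {𝓕 : Matrix (Fin 3) (Fin 3) ℝ} {s lam : ℂ} {ω₂ ω₃ : ℝ}

/-- The Lopatinski determinant equals, up to nonzero factors, `β² λ² + ((M² - M₁²) R - 1) |ω'|²`. -/
theorem lopatinskiNonzero_iff (hM : 0 < M) (hR : 0 < R) (hR1 : R ≠ 1)
    (hME : M ^ 2 < 1 + 𝓕 0 ⬝ᵥ 𝓕 0) (hT : s + lam ≠ 0)
    (hk : lam ^ 2 - (ω₂ ^ 2 + ω₃ ^ 2 : ℂ) ≠ 0)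
    (h : Dispersion M (1 + 𝓕 0 ⬝ᵥ 𝓕 0) (𝓕 0 ⬝ᵥ (ω₂ • 𝓕 1 + ω₃ • 𝓕 2))
      ((ω₂ • 𝓕 1 + ω₃ • 𝓕 2) ⬝ᵥ (ω₂ • 𝓕 1 + ω₃ • 𝓕 2) + (ω₂ ^ 2 + ω₃ ^ 2)) s lam) :
    LopatinskiNonzero M R 𝓕 s lam ω₂ ω₃ ↔
      ((1 + 𝓕 0 ⬝ᵥ 𝓕 0 - M ^ 2 : ℝ) : ℂ) * lam ^ 2
        + (((M ^ 2 - 𝓕 0 ⬝ᵥ 𝓕 0) * R - 1) * (ω₂ ^ 2 + ω₃ ^ 2) : ℝ) ≠ 0 := by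
  have h' := dispersion_acoustic_iff.1 h
  have hRc : (R : ℂ) ≠ 0 := by exact_mod_cast hR.ne'
  have hR1c : 1 - (R : ℂ) ≠ 0 := by
    rw [sub_ne_zero]; exact_mod_cast hR1.symm
  constructor
  · rintro ⟨i, U, -, ⟨φ, hv1, hp, hv2, hv3, hF1, hF2, hF3⟩, -, hdet⟩ h0
    have hpair := boundary_pairing hM hR hME h hv1 hp hv2 hv3 hF1 hF2 hF3
    rw [h0, mul_zero, mul_eq_zero] at hpair
    apply hdet
    refine Matrix.exists_mulVec_eq_zero_iff.1 ⟨_, acousticVec_ne_zero (𝓕 := 𝓕) (s := s) hk, ?_⟩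
    rw [lopatinskiMatrix, updateRow_mulVec, symbol_mulVec_acousticVec h', hpair.resolve_left hRc]
    exact Function.update_eq_self i 0
  · intro hD
    -- The solution of the boundary conditions with `(1 - R) φ = 1`.
    have ha : (a₀ M R 𝓕 : ℂ) ≠ 0 := by
      have hβ : 0 < β M 𝓕 := by
        rw [β, MStar, vnorm, Real.sq_sqrt (dotProduct_self_nonneg _), Real.sq_sqrt]
        · exact Real.sqrt_pos.2 (by linarith)
        · linarith [dotProduct_self_nonneg (𝓕 0)]
      have : a₀ M R 𝓕 ≠ 0 := by
        unfold a₀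
        have : 0 < β M 𝓕 ^ 2 * R := by positivity
        exact div_ne_zero (by linarith) (by positivity)
      exact_mod_cast this
    let P : ℂ := -dStar M 𝓕 s ω₂ ω₃ / a₀ M R 𝓕
    let V₂ : ℂ := -(Complex.I * ω₂)
    let V₃ : ℂ := -(Complex.I * ω₃)
    let U : Idx → ℂ := fun
      | Sum.inl _ => P
      | Sum.inr (Sum.inl k) =>
        ![1 / ((M : ℂ) ^ 2 * R) * (ℓ₂ 𝓕 * V₂ + ℓ₃ 𝓕 * V₃) - d₀ M 𝓕 * P, V₂, V₃] k
      | Sum.inr (Sum.inr (k, j)) =>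
        ![1 / (R : ℂ) * (𝓕 1 j * V₂ + 𝓕 2 j * V₃) - 𝓕 0 j * P, 𝓕 0 j * V₂, 𝓕 0 j * V₃] k
    have hv1 : U (iv 0) + d₀ M 𝓕 * U ip
        - 1 / ((M : ℂ) ^ 2 * R) * (ℓ₂ 𝓕 * U (iv 1) + ℓ₃ 𝓕 * U (iv 2)) = 0 := by
      simp [U]
    have hp : a₀ M R 𝓕 * U ip + (1 - (R : ℂ)) * (dStar M 𝓕 s ω₂ ω₃ * (1 / (1 - R))) = 0 := by
      simp only [U, P]
      field_simp
      ring
    have hv2 : U (iv 1) + (1 - (R : ℂ)) * (Complex.I * ω₂ * (1 / (1 - R))) = 0 := by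
      simp [U, V₂]
      field_simp
      ring
    have hv3 : U (iv 2) + (1 - (R : ℂ)) * (Complex.I * ω₃ * (1 / (1 - R))) = 0 := by
      simp [U, V₃]
      field_simp
      ring
    have hF1 : ∀ j : Fin 3, U (iF 0 j) + 𝓕 0 j * U ip
        - 1 / (R : ℂ) * (𝓕 1 j * U (iv 1) + 𝓕 2 j * U (iv 2)) = 0 := by
      intro j; simp [U]
    have hF2 : ∀ j : Fin 3, U (iF 1 j) - 𝓕 0 j * U (iv 1) = 0 := by
      intro j; simp [U]
    have hF3 : ∀ j : Fin 3, U (iF 2 j) - 𝓕 0 j * U (iv 2) = 0 := by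
      intro j; simp [U]
    have hpair := boundary_pairing hM hR hME h hv1 hp hv2 hv3 hF1 hF2 hF3
    have hY : ((coeffA M 𝓕 0).map Complex.ofReal *ᵥ U) ⬝ᵥ acousticVec 𝓕 s lam ω₂ ω₃ ≠ 0 := by
      intro h0
      rw [h0, mul_zero, mul_one_div_cancel hR1c, one_mul] at hpair
      exact mul_ne_zero hT hD hpair.symm
    refine ⟨ip, U, ?_, ⟨_, hv1, hp, hv2, hv3, hF1, hF2, hF3⟩, ?_, ?_⟩
    · intro h0
      rw [h0, mulVec_zero, zero_dotProduct] at hY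
      exact hY rfl
    · -- A linear relation between the rows lies in the kernel of the symmetric symbol; since its
      -- pressure component is zero, it is the zero multiple of the acoustic vector.
      rw [Fintype.linearIndependent_iff]
      intro g hg
      let X : Idx → ℂ := fun r => if hr : r ≠ ip then g ⟨r, hr⟩ else 0
      have hX : symbol M 𝓕 s lam ω₂ ω₃ *ᵥ X = 0 := by
        rw [← symbol_transpose, mulVec_transpose]
        rw [← hg]
        funext c
        rw [vecMul, dotProduct, Finset.sum_apply,
          ← Fintype.sum_subtype_add_sum_subtype (fun r => r ≠ ip)]
        have h1 : ∀ r : {r : Idx // r ≠ ip}, X r = g r := fun r => dif_pos r.2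
        have h2 : ∀ r : {r : Idx // ¬ r ≠ ip}, X r = 0 := fun r => dif_neg r.2
        simp [h1, h2]
      obtain ⟨c, hc⟩ := eq_smul_acousticVec hT hk h' hX
      have hc0 : c = 0 := by
        have := congrFun hc ip
        simp only [X, ne_eq, not_true_eq_false, dite_false, Pi.smul_apply, acousticVec, smul_eq_mul]
          at this
        exact (mul_eq_zero.1 this.symm).resolve_right (neg_ne_zero.2 hk)
      rintro ⟨r, hr⟩
      have := congrFun hc r
      simpa [X, hr, hc0] using this
    · intro hdet
      obtain ⟨X, hX0, hX⟩ := Matrix.exists_mulVec_eq_zero_iff.2 hdet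
      rw [lopatinskiMatrix, updateRow_mulVec] at hX
      have hrow : ∀ r, r ≠ ip → (symbol M 𝓕 s lam ω₂ ω₃ *ᵥ X) r = 0 := by
        intro r hr
        have := congrFun hX r
        rwa [Function.update_of_ne hr] at this
      -- The omitted equation is a combination of the other ones.
      have hip : (symbol M 𝓕 s lam ω₂ ω₃ *ᵥ X) ip = 0 := by
        have h1 : acousticVec 𝓕 s lam ω₂ ω₃ ⬝ᵥ (symbol M 𝓕 s lam ω₂ ω₃ *ᵥ X) = 0 := by
          rw [dotProduct_mulVec, ← mulVec_transpose, symbol_transpose,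
            symbol_mulVec_acousticVec h', zero_dotProduct]
        rw [dotProduct, Finset.sum_eq_single ip (fun r _ hr => by rw [hrow r hr, mul_zero])
          (by simp)] at h1
        exact (mul_eq_zero.1 h1).resolve_left (neg_ne_zero.2 hk)
      have hker : symbol M 𝓕 s lam ω₂ ω₃ *ᵥ X = 0 := by
        funext r
        by_cases hr : r = ip
        · rw [hr]; exact hip
        · exact hrow r hr
      obtain ⟨c, hc⟩ := eq_smul_acousticVec hT hk h' hker
      have h2 := congrFun hX ip
      rw [Function.update_self, hc, dotProduct_smul, Pi.zero_apply, smul_eq_zero] at h2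
      rw [hc, h2.resolve_right hY, zero_smul] at hX0
      exact hX0 rfl

end

/-! ### The acoustic root on the imaginary axis -/

section

variable {M E ℓ C ξ η : ℝ}

theorem sqrtDiscIm_mul_nonneg : 0 ≤ sqrtDiscIm M E ℓ C ξ η * (E * ξ - ℓ) := by
  unfold sqrtDiscIm
  split_ifs with h
  · rw [one_mul]
    exact mul_nonneg (Real.sqrt_nonneg _) (by linarith)
  · have := mul_nonneg (Real.sqrt_nonneg ((√(discRe M E ℓ C ξ η ^ 2 + discIm M E ℓ ξ η ^ 2)
      - discRe M E ℓ C ξ η) / 2)) (sub_nonneg.2 (not_le.1 h).le)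
    linarith

/-- At `η = 0`, an imaginary acoustic root obeys a lower bound, which comes from the glancing
frequencies, where the discriminant vanishes. -/
theorem le_mul_abs_im_acousticRoot (hM : 0 < M) (hME : M ^ 2 < E) (hN : ℓ ^ 2 ≤ E * C)
    (h : (acousticRoot M E ℓ C ξ 0).re = 0) :
    M * √(E * C - ℓ ^ 2) - |ℓ| * √(E - M ^ 2)
      ≤ E * (√(E - M ^ 2) * |(acousticRoot M E ℓ C ξ 0).im|) := by
  have h1 := sqrtDisc_sq_sub (M := M) (E := E) (ℓ := ℓ) (C := C) (ξ := ξ) (η := 0)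
  have h3 := mul_discRe (M := M) (E := E) (ℓ := ℓ) (C := C) (ξ := ξ) (η := 0)
  have h4 := sqrtDiscIm_mul_nonneg (M := M) (E := E) (ℓ := ℓ) (C := C) (ξ := ξ) (η := 0)
  have hd : 0 < E - M ^ 2 := by linarith
  have hE : 0 < E := lt_trans (by positivity) hME
  simp only [acousticRoot] at h ⊢
  set x := sqrtDiscRe M E ℓ C ξ 0
  set y := sqrtDiscIm M E ℓ C ξ 0
  have hx : x = 0 := by
    rw [div_eq_zero_iff] at h
    have := h.resolve_right hd.ne'
    linarith
  rw [← h1, hx] at h3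
  set b := √(E - M ^ 2)
  set N := √(E * C - ℓ ^ 2)
  have hb : 0 < b := Real.sqrt_pos.2 hd
  have hb2 : b ^ 2 = E - M ^ 2 := Real.sq_sqrt hd.le
  have hN2 : N ^ 2 = E * C - ℓ ^ 2 := Real.sq_sqrt (by linarith)
  rw [← hb2, ← hN2] at h3
  set t := E * ξ - ℓ with ht
  have hMt : b * N ≤ M * |t| := by
    rw [← sq_le_sq₀ (by positivity) (by positivity), mul_pow, mul_pow, sq_abs]
    nlinarith [mul_nonneg hE.le (sq_nonneg y)]
  have habs : M ^ 2 * |t| ≤ |M ^ 2 * t + E * y| := by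
    have e1 : 0 ≤ M ^ 2 * E * (y * t) := by positivity
    have e2 : 0 ≤ (E * y) ^ 2 := sq_nonneg _
    have e3 : |M ^ 2 * t| ≤ |M ^ 2 * t + E * y| := sq_le_sq.1 (by linarith)
    rwa [abs_mul, abs_of_pos (pow_pos hM 2)] at e3
  have him : E * (b ^ 2 * ((M ^ 2 * ξ - ℓ + y) / (E - M ^ 2)))
      = M ^ 2 * t + E * y - b ^ 2 * ℓ := by
    rw [hb2, mul_div_cancel₀ _ hd.ne', ht]
    ring
  have habs' : E * (b ^ 2 * |(M ^ 2 * ξ - ℓ + y) / (E - M ^ 2)|)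
      = |M ^ 2 * t + E * y - b ^ 2 * ℓ| := by
    rw [← him, abs_mul, abs_mul, abs_of_pos hE, abs_of_pos (pow_pos hb 2)]
  have htri := abs_sub_abs_le_abs_sub (M ^ 2 * t + E * y) (b ^ 2 * ℓ)
  rw [← habs', abs_mul (b ^ 2), abs_of_pos (pow_pos hb 2)] at htri
  have hMt' := mul_le_mul_of_nonneg_left hMt hM.le
  refine le_of_mul_le_mul_right ?_ hb
  linarith

/-- Every value beyond the glancing one is attained by the imaginary acoustic root. -/
theorem exists_acousticRoot_eq (hM : 0 < M) (hME : M ^ 2 < E) (hN : ℓ ^ 2 ≤ E * C) {γ : ℝ}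
    (h : M * √(E * C - ℓ ^ 2) - ℓ * √(E - M ^ 2) ≤ E * γ) :
    ∃ ξ : ℝ, (acousticRoot M E ℓ C ξ 0).re = 0 ∧
      √(E - M ^ 2) * (acousticRoot M E ℓ C ξ 0).im = γ := by
  have hd : 0 < E - M ^ 2 := by linarith
  have hE : 0 < E := lt_trans (by positivity) hME
  set b := √(E - M ^ 2)
  set N := √(E * C - ℓ ^ 2)
  have hb : 0 < b := Real.sqrt_pos.2 hd
  have hb2 : b ^ 2 = E - M ^ 2 := Real.sq_sqrt hd.le
  have hN0 : 0 ≤ N := Real.sqrt_nonneg _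
  have hN2 : N ^ 2 = E * C - ℓ ^ 2 := Real.sq_sqrt (by linarith)
  -- `f t = E β² Im λ⁺ + β² ℓ` as a function of `t = E ξ - ℓ`.
  let f : ℝ → ℝ := fun t => M ^ 2 * t + √(E * (M ^ 2 * t ^ 2 - b ^ 2 * N ^ 2))
  have hf : Continuous f := by fun_prop
  have ht₀ : 0 ≤ b * N / M := by positivity
  have hf₀ : f (b * N / M) ≤ E * b * γ + b ^ 2 * ℓ := by
    have e : M ^ 2 * (b * N / M) ^ 2 - b ^ 2 * N ^ 2 = 0 := by field_simp; ring
    have e' : M ^ 2 * (b * N / M) = M * b * N := by field_simp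
    simp only [f, e, e', mul_zero, Real.sqrt_zero, add_zero]
    nlinarith
  obtain ⟨t, ht, hft⟩ : ∃ t, b * N / M ≤ t ∧ f t = E * b * γ + b ^ 2 * ℓ := by
    set t₁ := max (b * N / M) ((E * b * γ + b ^ 2 * ℓ) / M ^ 2)
    have hf₁ : E * b * γ + b ^ 2 * ℓ ≤ f t₁ := by
      have h1 : (E * b * γ + b ^ 2 * ℓ) / M ^ 2 ≤ t₁ := le_max_right _ _
      rw [div_le_iff₀ (by positivity)] at h1
      have h2 := Real.sqrt_nonneg (E * (M ^ 2 * t₁ ^ 2 - b ^ 2 * N ^ 2))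
      simp only [f]
      linarith
    obtain ⟨t, ht, hft⟩ := intermediate_value_Icc (le_max_left (b * N / M)
      ((E * b * γ + b ^ 2 * ℓ) / M ^ 2)) hf.continuousOn ⟨hf₀, hf₁⟩
    exact ⟨t, ht.1, hft⟩
  refine ⟨(t + ℓ) / E, ?_⟩
  have hEξ : E * ((t + ℓ) / E) = t + ℓ := by field_simp
  have h3 := mul_discRe (M := M) (E := E) (ℓ := ℓ) (C := C) (ξ := (t + ℓ) / E) (η := 0)
  rw [hEξ, add_sub_cancel_right, ← hb2, ← hN2] at h3
  have ht0 : 0 ≤ t := ht₀.trans ht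
  have hsq : b ^ 2 * N ^ 2 ≤ M ^ 2 * t ^ 2 := by
    rw [div_le_iff₀ hM] at ht
    have := pow_le_pow_left₀ (by positivity) ht 2
    linarith
  have hneg : discRe M E ℓ C ((t + ℓ) / E) 0 ≤ 0 := by
    by_contra! hpos
    have := mul_pos hE hpos
    linarith
  have him : discIm M E ℓ ((t + ℓ) / E) 0 = 0 := by simp [discIm]
  have habs : √(discRe M E ℓ C ((t + ℓ) / E) 0 ^ 2 + discIm M E ℓ ((t + ℓ) / E) 0 ^ 2)
      = -discRe M E ℓ C ((t + ℓ) / E) 0 := by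
    rw [him]
    simp [Real.sqrt_sq_eq_abs, abs_of_nonpos hneg]
  have hx : sqrtDiscRe M E ℓ C ((t + ℓ) / E) 0 = 0 := by
    rw [sqrtDiscRe, habs]; simp
  have hy : E * sqrtDiscIm M E ℓ C ((t + ℓ) / E) 0 = √(E * (M ^ 2 * t ^ 2 - b ^ 2 * N ^ 2)) := by
    rw [sqrtDiscIm, habs, if_pos (by linarith), one_mul]
    have e : E * (M ^ 2 * t ^ 2 - b ^ 2 * N ^ 2)
        = E ^ 2 * ((-discRe M E ℓ C ((t + ℓ) / E) 0 - discRe M E ℓ C ((t + ℓ) / E) 0) / 2) := by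
      linear_combination E * h3
    rw [e, Real.sqrt_mul (sq_nonneg E), Real.sqrt_sq hE.le]
  constructor
  · simp [acousticRoot, hx]
  · simp only [acousticRoot, f] at hft ⊢
    rw [← hy] at hft
    rw [← hb2]
    apply mul_left_cancel₀ (mul_pos hE hb).ne'
    field_simp
    linear_combination hft + ℓ * hb2

end

/-! ### The Kreiss-Lopatinski conditions -/

section

variable {M R : ℝ} {𝓕 : Matrix (Fin 3) (Fin 3) ℝ}

theorem cross_dotProduct_self (a b : Fin 3 → ℝ) :
    crossProduct a b ⬝ᵥ crossProduct a b = (a ⬝ᵥ a) * (b ⬝ᵥ b) - (a ⬝ᵥ b) ^ 2 := by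
  rw [cross_dot_cross, dotProduct_comm b a]; ring

theorem dotProduct_sq_le (a b : Fin 3 → ℝ) : (a ⬝ᵥ b) ^ 2 ≤ (a ⬝ᵥ a) * (b ⬝ᵥ b) := by
  have := dotProduct_self_nonneg (crossProduct a b)
  rw [cross_dotProduct_self] at this
  linarith

theorem vnorm_sq (a : Fin 3 → ℝ) : vnorm a ^ 2 = a ⬝ᵥ a := Real.sq_sqrt (dotProduct_self_nonneg a)

/-- The root `λ⁺` at `s = η + i ξ`. -/
noncomputable def lambdaPlus (M : ℝ) (𝓕 : Matrix (Fin 3) (Fin 3) ℝ) (ω₂ ω₃ ξ η : ℝ) : ℂ :=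
  acousticRoot M (1 + 𝓕 0 ⬝ᵥ 𝓕 0) (𝓕 0 ⬝ᵥ (ω₂ • 𝓕 1 + ω₃ • 𝓕 2))
    ((ω₂ • 𝓕 1 + ω₃ • 𝓕 2) ⬝ᵥ (ω₂ • 𝓕 1 + ω₃ • 𝓕 2) + (ω₂ ^ 2 + ω₃ ^ 2)) ξ η

/-- The quantity `N² = M_*² (|b|² + |ω'|²) - ℓ²` is nonnegative. -/
theorem dotProduct_sq_le_acoustic (ω₂ ω₃ : ℝ) : (𝓕 0 ⬝ᵥ (ω₂ • 𝓕 1 + ω₃ • 𝓕 2)) ^ 2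
    ≤ (1 + 𝓕 0 ⬝ᵥ 𝓕 0) *
      ((ω₂ • 𝓕 1 + ω₃ • 𝓕 2) ⬝ᵥ (ω₂ • 𝓕 1 + ω₃ • 𝓕 2) + (ω₂ ^ 2 + ω₃ ^ 2)) := by
  have h1 := dotProduct_sq_le (𝓕 0) (ω₂ • 𝓕 1 + ω₃ • 𝓕 2)
  have h2 := dotProduct_self_nonneg (ω₂ • 𝓕 1 + ω₃ • 𝓕 2)
  have h3 : 0 ≤ (1 + 𝓕 0 ⬝ᵥ 𝓕 0) * (ω₂ ^ 2 + ω₃ ^ 2) :=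
    mul_nonneg (by linarith [dotProduct_self_nonneg (𝓕 0)]) (by positivity)
  linarith

theorem lambdaPlus_nondegenerate (hM : 0 < M) (hAM : 𝓕 0 ⬝ᵥ 𝓕 0 < M ^ 2)
    (hME : M ^ 2 < 1 + 𝓕 0 ⬝ᵥ 𝓕 0) {ω₂ ω₃ ξ η : ℝ} (hη : 0 ≤ η)
    (hne : η ≠ 0 ∨ ξ ≠ 0 ∨ ω₂ ≠ 0 ∨ ω₃ ≠ 0) :
    η + Complex.I * ξ + lambdaPlus M 𝓕 ω₂ ω₃ ξ η ≠ 0 ∧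
      lambdaPlus M 𝓕 ω₂ ω₃ ξ η ^ 2 - (ω₂ ^ 2 + ω₃ ^ 2 : ℂ) ≠ 0 := by
  have hω : ω₂ ^ 2 + ω₃ ^ 2 = 0 → ω₂ = 0 ∧ ω₃ = 0 := fun h => by
    constructor <;> nlinarith [sq_nonneg ω₂, sq_nonneg ω₃]
  have := acoustic_mode_nondegenerate (s := η + Complex.I * ξ) hM (dotProduct_self_nonneg (𝓕 0)) hAM
    (dotProduct_self_nonneg (ω₂ • 𝓕 1 + ω₃ • 𝓕 2)) (add_nonneg (sq_nonneg ω₂) (sq_nonneg ω₃))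
    (dotProduct_sq_le (𝓕 0) (ω₂ • 𝓕 1 + ω₃ • 𝓕 2))
    (fun h => by rw [(hω h).1, (hω h).2]; simp) (by simpa using hη)
    (acousticRoot_re_nonneg hME hη) ?_ (dispersion_acousticRoot hME hη)
  · simpa [lambdaPlus] using this
  · by_contra! h0
    have h1 := congrArg Complex.re h0.1
    have h2 := congrArg Complex.im h0.1
    have h3 := hω h0.2
    simp at h1 h2
    simp [h1, h2, h3.1, h3.2] at hne

theorem isLambdaPlus_lambdaPlus (hM : 0 < M) (hAM : 𝓕 0 ⬝ᵥ 𝓕 0 < M ^ 2)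
    (hME : M ^ 2 < 1 + 𝓕 0 ⬝ᵥ 𝓕 0) {ω₂ ω₃ ξ η : ℝ} (hη : 0 < η) :
    IsLambdaPlus M 𝓕 (η + Complex.I * ξ) ω₂ ω₃ (lambdaPlus M 𝓕 ω₂ ω₃ ξ η) := by
  refine ⟨?_, acousticRoot_re_pos hM hME hη, fun μ hdet hμ => ?_⟩
  · exact Matrix.exists_mulVec_eq_zero_iff.1
      ⟨_, acousticVec_ne_zero (lambdaPlus_nondegenerate hM hAM hME hη.le (Or.inl hη.ne')).2,
        symbol_mulVec_acousticVec (dispersion_acoustic_iff.1 (dispersion_acousticRoot hME hη.le))⟩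
  · have hT : η + Complex.I * ξ + μ ≠ 0 := by
      intro h
      have := congrArg Complex.re h
      simp at this
      linarith
    rcases dispersion_of_det_symbol_eq_zero hT hdet with h | h
    · exact absurd h (not_dispersion_shear hM (dotProduct_self_nonneg _) hAM
        (dotProduct_self_nonneg _) (dotProduct_sq_le _ _) (by simpa using hη.le) hμ)
    · exact eq_acousticRoot hM hME (dotProduct_sq_le_acoustic ω₂ ω₃) hη h hμ

theorem lopatinskiNonzero_lambdaPlus_iff (hM : 0 < M) (hR : 0 < R) (hR1 : R ≠ 1)
    (hAM : 𝓕 0 ⬝ᵥ 𝓕 0 < M ^ 2) (hME : M ^ 2 < 1 + 𝓕 0 ⬝ᵥ 𝓕 0) {ω₂ ω₃ ξ η : ℝ} (hη : 0 ≤ η)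
    (hne : η ≠ 0 ∨ ξ ≠ 0 ∨ ω₂ ≠ 0 ∨ ω₃ ≠ 0) :
    LopatinskiNonzero M R 𝓕 (η + Complex.I * ξ) (lambdaPlus M 𝓕 ω₂ ω₃ ξ η) ω₂ ω₃ ↔
      ((1 + 𝓕 0 ⬝ᵥ 𝓕 0 - M ^ 2 : ℝ) : ℂ) * lambdaPlus M 𝓕 ω₂ ω₃ ξ η ^ 2
        + (((M ^ 2 - 𝓕 0 ⬝ᵥ 𝓕 0) * R - 1) * (ω₂ ^ 2 + ω₃ ^ 2) : ℝ) ≠ 0 :=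
  have h := lambdaPlus_nondegenerate hM hAM hME hη hne
  lopatinskiNonzero_iff hM hR hR1 hME h.1 h.2 (dispersion_acousticRoot hME hη)

/-- A shock which satisfies the Lax conditions behind the front is never violently unstable. -/
theorem KL_of_lax (hM : 0 < M) (hR : 0 < R) (hR1 : R ≠ 1)
    (hAM : 𝓕 0 ⬝ᵥ 𝓕 0 < M ^ 2) (hME : M ^ 2 < 1 + 𝓕 0 ⬝ᵥ 𝓕 0) : KL M R 𝓕 := by
  intro η ξ ω₂ ω₃ hη
  refine ⟨_, isLambdaPlus_lambdaPlus hM hAM hME hη,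
    (lopatinskiNonzero_lambdaPlus_iff hM hR hR1 hAM hME hη.le (Or.inl hη.ne')).2 ?_⟩
  exact reduced_lopatinski_ne_zero hM hAM hME (dotProduct_self_nonneg _) (by positivity)
    (dotProduct_sq_le _ _) hR (by simpa using hη.le) (acousticRoot_re_pos hM hME hη)
    (dispersion_acousticRoot hME hη.le)

/-- The uniform condition adds to the Kreiss-Lopatinski condition, which always holds, only the
nonvanishing of the reduced determinant at `η = 0`. -/
theorem UKL_iff_boundary (hM : 0 < M) (hR : 0 < R) (hR1 : R ≠ 1)
    (hAM : 𝓕 0 ⬝ᵥ 𝓕 0 < M ^ 2) (hME : M ^ 2 < 1 + 𝓕 0 ⬝ᵥ 𝓕 0) :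
    UKL M R 𝓕 ↔ ∀ ξ ω₂ ω₃ : ℝ, (ξ ≠ 0 ∨ ω₂ ≠ 0 ∨ ω₃ ≠ 0) →
      ((1 + 𝓕 0 ⬝ᵥ 𝓕 0 - M ^ 2 : ℝ) : ℂ) * lambdaPlus M 𝓕 ω₂ ω₃ ξ 0 ^ 2
        + (((M ^ 2 - 𝓕 0 ⬝ᵥ 𝓕 0) * R - 1) * (ω₂ ^ 2 + ω₃ ^ 2) : ℝ) ≠ 0 := by
  have hlim : ∀ ξ ω₂ ω₃ : ℝ,
      Tendsto (lambdaPlus M 𝓕 ω₂ ω₃ ξ) (𝓝[>] 0) (𝓝 (lambdaPlus M 𝓕 ω₂ ω₃ ξ 0)) := fun ξ ω₂ ω₃ =>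
    ((continuous_acousticRoot _ _ _ _ ξ).tendsto 0).mono_left nhdsWithin_le_nhds
  have hiff := fun {ω₂ ω₃ ξ : ℝ} (hne : ξ ≠ 0 ∨ ω₂ ≠ 0 ∨ ω₃ ≠ 0) =>
    lopatinskiNonzero_lambdaPlus_iff (ω₂ := ω₂) (ω₃ := ω₃) (ξ := ξ) hM hR hR1 hAM hME le_rfl
      (Or.inr hne)
  simp only [Complex.ofReal_zero, zero_add] at hiff
  constructor
  · rintro ⟨-, h⟩ ξ ω₂ ω₃ hne
    obtain ⟨L, lam₀, hL, hL₀, hlop⟩ := h ξ ω₂ ω₃ hne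
    have heq : L =ᶠ[𝓝[>] 0] lambdaPlus M 𝓕 ω₂ ω₃ ξ := by
      filter_upwards [self_mem_nhdsWithin] with η hη
      exact (isLambdaPlus_lambdaPlus hM hAM hME hη).2.2 _ (hL η hη).1 (hL η hη).2.1
    rw [tendsto_nhds_unique (hL₀.congr' heq) (hlim ξ ω₂ ω₃)] at hlop
    exact (hiff hne).1 hlop
  · intro h
    refine ⟨KL_of_lax hM hR hR1 hAM hME, fun ξ ω₂ ω₃ hne => ?_⟩
    exact ⟨lambdaPlus M 𝓕 ω₂ ω₃ ξ, _, fun η hη => isLambdaPlus_lambdaPlus hM hAM hME hη,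
      hlim ξ ω₂ ω₃, (hiff hne).2 (h ξ ω₂ ω₃ hne)⟩

/-! ### The stability inequality -/

/-- The quantity `M N - |ℓ| β` with `N² = M_*² (|b|² + |ω'|²) - ℓ²`. Divided by `M_*² β`, it is the
smallest modulus of an imaginary `λ⁺` at `η = 0` for the tangential frequencies `±ω'`. -/
noncomputable def glancingGap (M : ℝ) (𝓕 : Matrix (Fin 3) (Fin 3) ℝ) (ω₂ ω₃ : ℝ) : ℝ :=
  M * √((1 + 𝓕 0 ⬝ᵥ 𝓕 0) *
      ((ω₂ • 𝓕 1 + ω₃ • 𝓕 2) ⬝ᵥ (ω₂ • 𝓕 1 + ω₃ • 𝓕 2) + (ω₂ ^ 2 + ω₃ ^ 2))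
      - (𝓕 0 ⬝ᵥ (ω₂ • 𝓕 1 + ω₃ • 𝓕 2)) ^ 2)
    - |𝓕 0 ⬝ᵥ (ω₂ • 𝓕 1 + ω₃ • 𝓕 2)| * √(1 + 𝓕 0 ⬝ᵥ 𝓕 0 - M ^ 2)

theorem continuous_glancingGap : Continuous fun w : ℝ × ℝ => glancingGap M 𝓕 w.1 w.2 := by
  unfold glancingGap
  simp only [dotProduct, Fin.sum_univ_three, Pi.add_apply, Pi.smul_apply, smul_eq_mul]
  fun_prop

theorem glancingGap_neg (ω₂ ω₃ : ℝ) : glancingGap M 𝓕 (-ω₂) (-ω₃) = glancingGap M 𝓕 ω₂ ω₃ := by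
  have : (-ω₂) • 𝓕 1 + (-ω₃) • 𝓕 2 = -(ω₂ • 𝓕 1 + ω₃ • 𝓕 2) := by module
  unfold glancingGap
  rw [this]
  simp only [neg_dotProduct, dotProduct_neg, neg_neg, abs_neg, neg_sq]

theorem glancingGap_smul {c : ℝ} (hc : 0 ≤ c) (ω₂ ω₃ : ℝ) :
    glancingGap M 𝓕 (c * ω₂) (c * ω₃) = c * glancingGap M 𝓕 ω₂ ω₃ := by
  have : (c * ω₂) • 𝓕 1 + (c * ω₃) • 𝓕 2 = c • (ω₂ • 𝓕 1 + ω₃ • 𝓕 2) := by module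
  unfold glancingGap
  rw [this]
  set v := ω₂ • 𝓕 1 + ω₃ • 𝓕 2
  simp only [dotProduct_smul, smul_dotProduct, smul_eq_mul, abs_mul, abs_of_nonneg hc]
  have e : (1 + 𝓕 0 ⬝ᵥ 𝓕 0) * (c * (c * v ⬝ᵥ v) + ((c * ω₂) ^ 2 + (c * ω₃) ^ 2))
      - (c * 𝓕 0 ⬝ᵥ v) ^ 2
      = c ^ 2 * ((1 + 𝓕 0 ⬝ᵥ 𝓕 0) * (v ⬝ᵥ v + (ω₂ ^ 2 + ω₃ ^ 2)) - (𝓕 0 ⬝ᵥ v) ^ 2) := by ring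
  rw [e, Real.sqrt_mul (sq_nonneg c), Real.sqrt_sq hc]
  ring

theorem glancingGap_nonneg (hM : 0 < M) (hAM : 𝓕 0 ⬝ᵥ 𝓕 0 < M ^ 2)
    (hME : M ^ 2 < 1 + 𝓕 0 ⬝ᵥ 𝓕 0) (ω₂ ω₃ : ℝ) : 0 ≤ glancingGap M 𝓕 ω₂ ω₃ := by
  have h0 := dotProduct_sq_le_acoustic (𝓕 := 𝓕) ω₂ ω₃
  have h1 := dotProduct_sq_le (𝓕 0) (ω₂ • 𝓕 1 + ω₃ • 𝓕 2)
  have h2 := dotProduct_self_nonneg (ω₂ • 𝓕 1 + ω₃ • 𝓕 2)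
  have hA := dotProduct_self_nonneg (𝓕 0)
  unfold glancingGap
  set v := ω₂ • 𝓕 1 + ω₃ • 𝓕 2
  set A := 𝓕 0 ⬝ᵥ 𝓕 0
  set l := 𝓕 0 ⬝ᵥ v
  have hW : 0 ≤ ω₂ ^ 2 + ω₃ ^ 2 := by positivity
  set W := ω₂ ^ 2 + ω₃ ^ 2
  rw [sub_nonneg]
  rw [← sq_le_sq₀ (by positivity) (by positivity), mul_pow, mul_pow, sq_abs,
    Real.sq_sqrt (by linarith), Real.sq_sqrt (by linarith)]
  have h3 : l ^ 2 ≤ M ^ 2 * (v ⬝ᵥ v + W) := by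
    have e1 := mul_le_mul_of_nonneg_right hAM.le h2
    have e2 := mul_nonneg (sq_nonneg M) hW
    linarith
  have h4 := mul_le_mul_of_nonneg_left h3 (by linarith : 0 ≤ 1 + A)
  linarith

/-- The minimum over the unit circle exists by compactness, so that the inequality may be required
pointwise. -/
theorem stabilityInequality_iff :
    StabilityInequality M R 𝓕 ↔ ∀ w₂ w₃ : ℝ, w₂ ^ 2 + w₃ ^ 2 = 1 →
      (1 + 𝓕 0 ⬝ᵥ 𝓕 0) ^ 2 * (R * (M ^ 2 - 𝓕 0 ⬝ᵥ 𝓕 0) - 1) < glancingGap M 𝓕 w₂ w₃ ^ 2 := by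
  have hexpr : ∀ w₂ w₃ : ℝ, w₂ ^ 2 + w₃ ^ 2 = 1 →
      M * √(1 + vnorm (𝓕 0) ^ 2 + vnorm (w₂ • 𝓕 1 + w₃ • 𝓕 2) ^ 2
              + vnorm (crossProduct (𝓕 0) (w₂ • 𝓕 1 + w₃ • 𝓕 2)) ^ 2)
            - |𝓕 0 ⬝ᵥ (w₂ • 𝓕 1 + w₃ • 𝓕 2)| * √(1 + vnorm (𝓕 0) ^ 2 - M ^ 2)
        = glancingGap M 𝓕 w₂ w₃ := by
    intro w₂ w₃ hw
    unfold glancingGap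
    simp only [vnorm_sq, cross_dotProduct_self, hw]
    congr 3
    ring
  unfold StabilityInequality
  constructor
  · rintro ⟨m, ⟨-, hm⟩, hpos⟩ w₂ w₃ hw
    have := hm ⟨w₂, w₃, hw, rfl⟩
    rw [hexpr w₂ w₃ hw] at this
    rw [vnorm_sq] at hpos
    linarith
  · intro h
    have hcomp : IsCompact {w : ℝ × ℝ | w.1 ^ 2 + w.2 ^ 2 = 1} := by
      apply Metric.isCompact_of_isClosed_isBounded
      · exact isClosed_eq (by fun_prop) (by fun_prop)
      · refine (Metric.isBounded_closedBall (x := (0 : ℝ × ℝ)) (r := 1)).subset fun w hw => ?_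
        have hw : w.1 ^ 2 + w.2 ^ 2 = 1 := hw
        rw [mem_closedBall_zero_iff, Prod.norm_def, sup_le_iff]
        simp only [Real.norm_eq_abs, ← sq_le_one_iff_abs_le_one]
        constructor <;> nlinarith [sq_nonneg w.1, sq_nonneg w.2]
    obtain ⟨w, hw, hmin⟩ := hcomp.exists_isMinOn ⟨(1, 0), by simp⟩
      (continuous_glancingGap (M := M) (𝓕 := 𝓕) |>.pow 2).continuousOn
    refine ⟨glancingGap M 𝓕 w.1 w.2 ^ 2, ⟨⟨w.1, w.2, hw, by rw [hexpr _ _ hw]⟩, ?_⟩, ?_⟩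
    · rintro y ⟨w₂, w₃, hw', rfl⟩
      rw [hexpr _ _ hw']
      exact isMinOn_iff.1 hmin (w₂, w₃) hw'
    · have := h _ _ hw
      rw [vnorm_sq]
      linarith

theorem boundary_ne_zero_of_stabilityInequality (hM : 0 < M) (hR : 0 < R)
    (hAM : 𝓕 0 ⬝ᵥ 𝓕 0 < M ^ 2) (hME : M ^ 2 < 1 + 𝓕 0 ⬝ᵥ 𝓕 0) (h : StabilityInequality M R 𝓕)
    {ξ ω₂ ω₃ : ℝ} (hne : ξ ≠ 0 ∨ ω₂ ≠ 0 ∨ ω₃ ≠ 0) :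
    ((1 + 𝓕 0 ⬝ᵥ 𝓕 0 - M ^ 2 : ℝ) : ℂ) * lambdaPlus M 𝓕 ω₂ ω₃ ξ 0 ^ 2
        + (((M ^ 2 - 𝓕 0 ⬝ᵥ 𝓕 0) * R - 1) * (ω₂ ^ 2 + ω₃ ^ 2) : ℝ) ≠ 0 := by
  rw [stabilityInequality_iff] at h
  have hd : 0 < 1 + 𝓕 0 ⬝ᵥ 𝓕 0 - M ^ 2 := by linarith
  have hnd := lambdaPlus_nondegenerate hM hAM hME le_rfl (Or.inr hne)
  rcases (acousticRoot_re_nonneg hME le_rfl :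
    0 ≤ (lambdaPlus M 𝓕 ω₂ ω₃ ξ 0).re).eq_or_lt with h0 | h0
  · have hW : 0 ≤ ω₂ ^ 2 + ω₃ ^ 2 := by positivity
    rcases hW.eq_or_lt with hW | hW
    · -- For normal incidence the determinant reduces to `β² λ²`.
      have hc : (ω₂ ^ 2 + ω₃ ^ 2 : ℂ) = 0 := by exact_mod_cast hW.symm
      rw [hc, sub_zero] at hnd
      rw [← hW, mul_zero, Complex.ofReal_zero, add_zero]
      exact mul_ne_zero (by exact_mod_cast hd.ne') hnd.2
    · have hb := le_mul_abs_im_acousticRoot hM hME (dotProduct_sq_le_acoustic ω₂ ω₃) h0.symm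
      change glancingGap M 𝓕 ω₂ ω₃ ≤ (1 + 𝓕 0 ⬝ᵥ 𝓕 0) * (√(1 + 𝓕 0 ⬝ᵥ 𝓕 0 - M ^ 2)
        * |(lambdaPlus M 𝓕 ω₂ ω₃ ξ 0).im|) at hb
      have hb2 := pow_le_pow_left₀ (glancingGap_nonneg hM hAM hME ω₂ ω₃) hb 2
      rw [mul_pow, mul_pow, sq_abs, Real.sq_sqrt hd.le] at hb2
      set ρ := √(ω₂ ^ 2 + ω₃ ^ 2)
      have hρ : 0 < ρ := Real.sqrt_pos.2 hW
      have hρ2 : ρ ^ 2 = ω₂ ^ 2 + ω₃ ^ 2 := Real.sq_sqrt hW.le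
      have hs := h (ω₂ / ρ) (ω₃ / ρ) (by rw [div_pow, div_pow, ← add_div, ← hρ2]; field_simp)
      have hg := glancingGap_smul (M := M) (𝓕 := 𝓕) hρ.le (ω₂ / ρ) (ω₃ / ρ)
      rw [mul_div_cancel₀ _ hρ.ne', mul_div_cancel₀ _ hρ.ne'] at hg
      rw [hg, mul_pow] at hb2
      have hs' := mul_lt_mul_of_pos_left hs (pow_pos hρ 2)
      intro hz
      have hre := congrArg Complex.re hz
      have h0' : (lambdaPlus M 𝓕 ω₂ ω₃ ξ 0).re = 0 := h0.symm
      simp only [Complex.add_re, Complex.ofReal_re, Complex.ofReal_im, Complex.zero_re,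
        pow_two (lambdaPlus M 𝓕 ω₂ ω₃ ξ 0), Complex.mul_re, h0'] at hre
      rw [← hρ2] at hre
      have : (1 + 𝓕 0 ⬝ᵥ 𝓕 0) ^ 2
            * ((1 + 𝓕 0 ⬝ᵥ 𝓕 0 - M ^ 2) * (lambdaPlus M 𝓕 ω₂ ω₃ ξ 0).im ^ 2)
          = (1 + 𝓕 0 ⬝ᵥ 𝓕 0) ^ 2 * (((M ^ 2 - 𝓕 0 ⬝ᵥ 𝓕 0) * R - 1) * ρ ^ 2) := by
        congr 1
        linarith
      linarith
  · exact reduced_lopatinski_ne_zero hM hAM hME (dotProduct_self_nonneg _) (by positivity)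
      (dotProduct_sq_le _ _) hR (by simp) h0 (dispersion_acousticRoot hME le_rfl)

/-- If the inequality fails at some unit `ω'`, then the imaginary root takes the value which makes the
reduced determinant vanish. -/
theorem stabilityInequality_of_boundary_ne_zero (hM : 0 < M)
    (hME : M ^ 2 < 1 + 𝓕 0 ⬝ᵥ 𝓕 0)
    (h : ∀ ξ ω₂ ω₃ : ℝ, (ξ ≠ 0 ∨ ω₂ ≠ 0 ∨ ω₃ ≠ 0) →
      ((1 + 𝓕 0 ⬝ᵥ 𝓕 0 - M ^ 2 : ℝ) : ℂ) * lambdaPlus M 𝓕 ω₂ ω₃ ξ 0 ^ 2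
        + (((M ^ 2 - 𝓕 0 ⬝ᵥ 𝓕 0) * R - 1) * (ω₂ ^ 2 + ω₃ ^ 2) : ℝ) ≠ 0) :
    StabilityInequality M R 𝓕 := by
  rw [stabilityInequality_iff]
  by_contra! hcon
  -- By the symmetry `ω' ↦ -ω'` the sign of `ℓ` may be chosen.
  obtain ⟨w₂, w₃, hw, hgap, hl⟩ : ∃ w₂ w₃ : ℝ, w₂ ^ 2 + w₃ ^ 2 = 1 ∧
      glancingGap M 𝓕 w₂ w₃ ^ 2 ≤ (1 + 𝓕 0 ⬝ᵥ 𝓕 0) ^ 2 * (R * (M ^ 2 - 𝓕 0 ⬝ᵥ 𝓕 0) - 1) ∧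
      0 ≤ 𝓕 0 ⬝ᵥ (w₂ • 𝓕 1 + w₃ • 𝓕 2) := by
    obtain ⟨w₂, w₃, hw, hgap⟩ := hcon
    rcases le_total 0 (𝓕 0 ⬝ᵥ (w₂ • 𝓕 1 + w₃ • 𝓕 2)) with hl | hl
    · exact ⟨w₂, w₃, hw, hgap, hl⟩
    · refine ⟨-w₂, -w₃, by simpa using hw, by rwa [glancingGap_neg], ?_⟩
      have : (-w₂) • 𝓕 1 + (-w₃) • 𝓕 2 = -(w₂ • 𝓕 1 + w₃ • 𝓕 2) := by module
      rw [this, dotProduct_neg]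
      linarith
  have hd : 0 < 1 + 𝓕 0 ⬝ᵥ 𝓕 0 - M ^ 2 := by linarith
  have hE : 0 < 1 + 𝓕 0 ⬝ᵥ 𝓕 0 := by linarith [dotProduct_self_nonneg (𝓕 0)]
  have hκ : 0 ≤ R * (M ^ 2 - 𝓕 0 ⬝ᵥ 𝓕 0) - 1 :=
    nonneg_of_mul_nonneg_right ((sq_nonneg _).trans hgap) (pow_pos hE 2)
  set γ := √(R * (M ^ 2 - 𝓕 0 ⬝ᵥ 𝓕 0) - 1)
  have hγ2 : γ ^ 2 = R * (M ^ 2 - 𝓕 0 ⬝ᵥ 𝓕 0) - 1 := Real.sq_sqrt hκ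
  have hle : glancingGap M 𝓕 w₂ w₃ ≤ (1 + 𝓕 0 ⬝ᵥ 𝓕 0) * γ := by
    refine le_of_abs_le (abs_le_of_sq_le_sq ?_ (mul_nonneg hE.le (Real.sqrt_nonneg _)))
    rwa [mul_pow, hγ2]
  unfold glancingGap at hle
  rw [abs_of_nonneg hl] at hle
  obtain ⟨ξ, hre, him⟩ := exists_acousticRoot_eq hM hME (dotProduct_sq_le_acoustic w₂ w₃) hle
  have hne : w₂ ≠ 0 ∨ w₃ ≠ 0 := by
    by_contra! h0
    simp [h0.1, h0.2] at hw
  apply h ξ w₂ w₃ (Or.inr hne)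
  change (lambdaPlus M 𝓕 w₂ w₃ ξ 0).re = 0 at hre
  change √(1 + 𝓕 0 ⬝ᵥ 𝓕 0 - M ^ 2) * (lambdaPlus M 𝓕 w₂ w₃ ξ 0).im = γ at him
  have h2 : (1 + 𝓕 0 ⬝ᵥ 𝓕 0 - M ^ 2) * (lambdaPlus M 𝓕 w₂ w₃ ξ 0).im ^ 2
      = R * (M ^ 2 - 𝓕 0 ⬝ᵥ 𝓕 0) - 1 := by
    rw [← hγ2, ← him, mul_pow, Real.sq_sqrt hd.le]
  have hlam : lambdaPlus M 𝓕 w₂ w₃ ξ 0 = (lambdaPlus M 𝓕 w₂ w₃ ξ 0).im * Complex.I := by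
    apply Complex.ext <;> simp [hre]
  rw [hlam, mul_pow, Complex.I_sq, hw]
  have h2c : ((1 + 𝓕 0 ⬝ᵥ 𝓕 0 - M ^ 2 : ℝ) : ℂ) * ((lambdaPlus M 𝓕 w₂ w₃ ξ 0).im : ℂ) ^ 2
      = ((R * (M ^ 2 - 𝓕 0 ⬝ᵥ 𝓕 0) - 1 : ℝ) : ℂ) := by exact_mod_cast h2
  push_cast at h2c ⊢
  linear_combination -h2c

end

end ElasticShock

theorem theorem4p1 (S : ElasticShock.PlanarShock)
    (lax_minus : S.machMinus >
      S.mach / √(S.mach ^ 2 - ElasticShock.M₁ S.scaledF ^ 2))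
    (lax_plus : ElasticShock.M₁ S.scaledF < S.mach ∧ S.mach < ElasticShock.MStar S.scaledF) :
    (S.UniformlyStable ↔ ElasticShock.StabilityInequality S.mach S.ratio S.scaledF) ∧
    (¬ ElasticShock.StabilityInequality S.mach S.ratio S.scaledF → S.WeaklyStable) ∧
    ¬ S.ViolentlyUnstable := by
  have hc : 0 < S.cPlus := Real.sqrt_pos.2 S.hyperbolicPlus
  have hM : 0 < S.mach := div_pos S.vPlus_pos hc
  have hR : 0 < S.ratio := div_pos S.ρPlus_pos S.ρMinus_pos
  have hR1 : S.ratio ≠ 1 := fun h => S.ρ_jump ((div_eq_one_iff_eq S.ρMinus_pos.ne').1 h)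
  have hAM : S.scaledF 0 ⬝ᵥ S.scaledF 0 < S.mach ^ 2 := by
    rw [← ElasticShock.vnorm_sq]
    exact pow_lt_pow_left₀ lax_plus.1 (Real.sqrt_nonneg _) two_ne_zero
  have hME : S.mach ^ 2 < 1 + S.scaledF 0 ⬝ᵥ S.scaledF 0 := by
    rw [← ElasticShock.vnorm_sq]
    exact (Real.lt_sqrt hM.le).1 lax_plus.2
  have hKL := ElasticShock.KL_of_lax hM hR hR1 hAM hME
  have hiff : S.UniformlyStable ↔
      ElasticShock.StabilityInequality S.mach S.ratio S.scaledF :=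
    (ElasticShock.UKL_iff_boundary hM hR hR1 hAM hME).trans
      ⟨ElasticShock.stabilityInequality_of_boundary_ne_zero hM hME,
        fun h _ _ _ hne => ElasticShock.boundary_ne_zero_of_stabilityInequality hM hR hAM hME h hne⟩
  exact ⟨hiff, fun h => ⟨hKL, fun hU => h (hiff.1 hU)⟩, fun h => h hKL⟩
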